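/- **Setting.** Let $f\colon X\to X$ be a continuous map of a metric space $(X,d)$ with its Borel $\sigma$-algebra, and let $a_\chi(n)=n^\chi$ ($\chi\in[0,\infty)$) be the family of polynomial scales. *Slow topological entropy.* For $K\subset X$ compact, let $N_{f,K}(\epsilon,n)$ be the minimal number of Bowen balls $\{y: d(f^i x,f^i y)<\epsilon,\ 0\le i<n\}$ needed to cover $K$. Put $$h_{\mathrm{top},a_\chi}(f)=\sup_{K}\ \lim_{\epsilon\to0}\ \sup\Big\{\chi\ge 0:\ \limsup_{n\to\infty}\frac{N_{f,K}(\epsilon,n)}{a_\chi(n)}>0\Big\}.$$ *Slow metric entropy.* For an $f$-invariant Borel probability measure $\mu$ and a finite measurable partition $\mathcal P$ of $X$, let $\bar d^{\,n}_{f,\mathcal P}(x,y)$ be the proportion of times $0\le s<n$ at which $f^s x$ and $f^s y$ lie in different atoms of $\mathcal P$, and let $S_{f,\mathcal P}(\epsilon,n)$ be the minimal cardinality of a finite set $F\subset X$ such that $\mu\big(\bigcup_{x\in F}\{y:\bar d^{\,n}_{f,\mathcal P}(x,y)<\epsilon\}\big)>1-\epsilon$. Put $$h_{\mu,a_\chi}(f)=\sup_{\mathcal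 P}\ \lim_{\epsilon\to0}\ \sup\Big\{\chi\ge 0:\ \limsup_{n\to\infty}\frac{S_{f,\mathcal P}(\epsilon,n)}{a_\chi(n)}>0\Big\}.$$ (The supremum of the empty set is $0$.) The map $f$ is *variational at polynomial scale* if $h_{\mathrm{top},a_\chi}(f)=\sup_\mu h_{\mu,a_\chi}(f)$, the supremum being over all $f$-invariant Borel probability measures $\mu$. *Sturmian subshifts.* A sequence $u\in\{0,1\}^{\mathbb Z}$ is Sturmian if for every $n\ge1$ exactly $n+1$ words of length $n$ appear in $u$, and $u$ is not eventually periodic. Its Sturmian subshift is the shift map $(\sigma\omega)_i=\omega_{i+1}$ on $X_u=\overline{\{\sigma^k u:k\in\mathbb Z\}}$, with the metric $d(\omega,\eta)=2^{-k}$, $k=\inf\{i\ge0:\omega_i\ne\eta_i\text{ or }\omega_{-i}\ne\eta_{-i}\}$. *Denjoy circle homeomorphisms.* An (orientation-preserving) homeomorphism $f$ of $S^1=\mathbb R/\mathbb Z$ is Denjoy if its rotation number $\theta$ is irrational and there are a continuous surjection $h\colon S^1\to S^1$ and a point $x_0\in S^1$ such that, with $R_\theta(x)=x+\theta$: $h\circ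 f=R_\theta\circ h$; $h^{-1}(R_\theta^n(x_0))$ is a nontrivial closed interval for all $n\in\mathbb Z$; and $h^{-1}(x)$ is a single point for every $x$ outside the $R_\theta$-orbit $\{R_\theta^n(x_0):n\in\mathbb Z\}$. **Theorem.** Let $f$ be a Sturmian subshift or a Denjoy circle homeomorphism. Then $f$ is not variational at polynomial scale. More precisely, $h_{\mathrm{top},a_\chi}(f)=1$, while $f$ has exactly one invariant Borel probability measure, and $h_{\mu,a_\chi}(f)=0$ for every invariant Borel probability measure $\mu$. -/

import Mathlib

open Set Filter Topology MeasureTheory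
open scoped ENNReal NNReal

/-! ### Slow entropy with respect to a family of scales -/

section SlowEntropy

/-- The family of polynomial scales `a_χ(n) = n ^ χ`, `χ ≥ 0`. -/
noncomputable def polyScale (χ : ℝ≥0) (n : ℕ) : ℝ := (n : ℝ) ^ (χ : ℝ)

/-- For a sequence of counts `N n` (possibly infinite) and a family of scales `a_χ`, the number
`sup {χ ≥ 0 : limsup_{n → ∞} N n / a_χ(n) > 0}` in `[0, ∞]`; the supremum of the empty set is `0`. -/
noncomputable def growthExponent (a : ℝ≥0 → ℕ → ℝ) (N : ℕ → ℕ∞) : ℝ≥0∞ :=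
  ⨆ (χ : ℝ≥0) (_ : 0 < limsup (fun n => (N n : ℝ≥0∞) / ENNReal.ofReal (a χ n)) atTop), (χ : ℝ≥0∞)

/-- Larger counts have a larger growth exponent. -/
theorem growthExponent_mono (a : ℝ≥0 → ℕ → ℝ) {N M : ℕ → ℕ∞} (h : ∀ n, N n ≤ M n) :
    growthExponent a N ≤ growthExponent a M := by
  refine iSup_mono fun χ => iSup_mono' fun hχ => ⟨lt_of_lt_of_le hχ ?_, le_rfl⟩
  refine limsup_le_limsup (Eventually.of_forall fun n => ?_)
  exact ENNReal.div_le_div_right (by exact_mod_cast h n) _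

/-- An antitone function of `ε` has a limit as `ε → 0⁺`, and this limit is its `limsup`. -/
theorem tendsto_limsup_of_antitone {g : ℝ → ℝ≥0∞} (hg : Antitone g) :
    Tendsto g (𝓝[>] 0) (𝓝 (limsup g (𝓝[>] 0))) := by
  have h := hg.tendsto_nhdsGT 0
  rwa [h.limsup_eq]

variable {X : Type*}

/-- The minimal number of `(ε, n)`-Bowen balls
`{y : dist (f^i x) (f^i y) < ε for 0 ≤ i < n}` that are needed to cover `K`. -/
noncomputable def bowenCoverNumber [PseudoMetricSpace X] (f : X → X) (K : Set X) (ε : ℝ) (n : ℕ) :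
    ℕ∞ :=
  Dynamics.coverMincard f K {p : X × X | dist p.1 p.2 < ε} n

/-- The slow topological entropy of `f` at the family of scales `a`:
`sup_K lim_{ε → 0} sup {χ : limsup_n N_{f,K}(ε, n) / a_χ(n) > 0}` over the compact sets `K`. The
limit as `ε → 0` exists (`tendsto_bowenCoverNumber`) and is written as a `limsup`. -/
noncomputable def topSlowEntropy [PseudoMetricSpace X] (f : X → X) (a : ℝ≥0 → ℕ → ℝ) : ℝ≥0∞ :=
  ⨆ (K : Set X) (_ : IsCompact K),
    limsup (fun ε : ℝ => growthExponent a (bowenCoverNumber f K ε)) (𝓝[>] 0)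

theorem tendsto_bowenCoverNumber [PseudoMetricSpace X] (f : X → X) (a : ℝ≥0 → ℕ → ℝ) (K : Set X) :
    Tendsto (fun ε : ℝ => growthExponent a (bowenCoverNumber f K ε)) (𝓝[>] 0)
      (𝓝 (limsup (fun ε : ℝ => growthExponent a (bowenCoverNumber f K ε)) (𝓝[>] 0))) := by
  refine tendsto_limsup_of_antitone fun ε δ hεδ => growthExponent_mono a fun n => ?_
  exact Dynamics.coverMincard_antitone f K n fun p (hp : dist p.1 p.2 < ε) => hp.trans_le hεδ

/-- The Hamming distance of the orbit segments of length `n` of `x` and `y` with respect to the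
partition of `X` into the sets `P ⁻¹' {j}`. -/
noncomputable def hammingDistance {k : ℕ} (f : X → X) (P : X → Fin k) (n : ℕ) (x y : X) : ℝ :=
  1 - (((Finset.range n).filter fun s => P (f^[s] x) = P (f^[s] y)).card : ℝ) / n

/-- The `(ε, n)`-Hamming ball centered at `x`. -/
def hammingBall {k : ℕ} (f : X → X) (P : X → Fin k) (n : ℕ) (ε : ℝ) (x : X) : Set X :=
  {y | hammingDistance f P n x y < ε}

/-- The minimal cardinality of a finite set `F` such that the `(ε, n)`-Hamming balls centered at the
points of `F` have a union of measure `> 1 - ε`. -/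
noncomputable def hammingCoverNumber [MeasurableSpace X] {k : ℕ} (μ : Measure X) (f : X → X)
    (P : X → Fin k) (ε : ℝ) (n : ℕ) : ℕ∞ :=
  ⨅ (F : Finset X) (_ : 1 - ε < μ.real (⋃ x ∈ F, hammingBall f P n ε x)), (F.card : ℕ∞)

/-- The slow metric entropy of `f` with respect to `μ` at the family of scales `a`: the supremum
over all finite measurable partitions `(P ⁻¹' {j})_j` of
`lim_{ε → 0} sup {χ : limsup_n S_{f,P}(ε, n) / a_χ(n) > 0}`. For a probability measure the limit as
`ε → 0` exists (`tendsto_hammingCoverNumber`); it is written as a `limsup`. -/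
noncomputable def metricSlowEntropy [MeasurableSpace X] (μ : Measure X) (f : X → X)
    (a : ℝ≥0 → ℕ → ℝ) : ℝ≥0∞ :=
  ⨆ (k : ℕ) (P : X → Fin k) (_ : Measurable P),
    limsup (fun ε : ℝ => growthExponent a (hammingCoverNumber μ f P ε)) (𝓝[>] 0)

theorem tendsto_hammingCoverNumber [MeasurableSpace X] {k : ℕ} (μ : Measure X)
    [IsProbabilityMeasure μ] (f : X → X) (P : X → Fin k) (a : ℝ≥0 → ℕ → ℝ) :
    Tendsto (fun ε : ℝ => growthExponent a (hammingCoverNumber μ f P ε)) (𝓝[>] 0)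
      (𝓝 (limsup (fun ε : ℝ => growthExponent a (hammingCoverNumber μ f P ε)) (𝓝[>] 0))) := by
  refine tendsto_limsup_of_antitone fun ε δ hεδ => growthExponent_mono a fun n => ?_
  refine le_iInf₂ fun F hF => iInf₂_le F ?_
  have hsub : (⋃ x ∈ F, hammingBall f P n ε x) ⊆ ⋃ x ∈ F, hammingBall f P n δ x :=
    iUnion₂_mono fun x _ y (hy : hammingDistance f P n x y < ε) => hy.trans_le hεδ
  have := measureReal_mono (μ := μ) hsub (measure_ne_top _ _)
  linarith

/-- The set of `f`-invariant probability measures. -/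
def invariantMeasures [MeasurableSpace X] (f : X → X) : Set (Measure X) :=
  {μ | IsProbabilityMeasure μ ∧ MeasurePreserving f μ μ}

/-- `f` is variational at the family of scales `a`: its slow topological entropy is the supremum of
the slow metric entropies over all invariant Borel probability measures. -/
def IsVariational [PseudoMetricSpace X] [MeasurableSpace X] [BorelSpace X] (f : X → X)
    (a : ℝ≥0 → ℕ → ℝ) : Prop :=
  topSlowEntropy f a = ⨆ μ ∈ invariantMeasures f, metricSlowEntropy μ f a

end SlowEntropy

/-! ### Sturmian subshifts -/

section Sturmian

/-- The distance `2 ^ (-k)` on `{0,1}^ℤ`, where `k` is the least `i ≥ 0` with `ω i ≠ η i` or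
`ω (-i) ≠ η (-i)` (and `2 ^ (-∞) = 0`). -/
noncomputable def shiftDist (ω η : ℤ → Bool) : ℝ :=
  open Classical in
  if ω = η then 0 else (1 / 2) ^ sInf {i : ℕ | ω i ≠ η i ∨ ω (-i) ≠ η (-i)}

theorem shiftDist_lt_iff (ω η : ℤ → Bool) (m : ℕ) :
    shiftDist ω η < (1 / 2) ^ m ↔ ∀ i : ℕ, i ≤ m → ω i = η i ∧ ω (-i) = η (-i) := by
  classical
  by_cases h : ω = η
  · simp [shiftDist, h]
  · have hne : {i : ℕ | ω i ≠ η i ∨ ω (-i) ≠ η (-i)}.Nonempty := by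
      obtain ⟨j, hj⟩ := Function.ne_iff.1 h
      rcases Int.eq_nat_or_neg j with ⟨i, rfl | rfl⟩
      · exact ⟨i, Or.inl hj⟩
      · exact ⟨i, Or.inr hj⟩
    rw [shiftDist, if_neg h, pow_lt_pow_iff_right_of_lt_one₀ (by norm_num) (by norm_num)]
    constructor
    · intro hm i hi
      have := Nat.notMem_of_lt_sInf (hi.trans_lt hm)
      simpa [not_or] using this
    · intro H
      by_contra! hle
      have h1 := Nat.sInf_mem hne
      have h2 := H _ hle
      rcases h1 with h1 | h1
      · exact h1 h2.1
      · exact h1 h2.2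

theorem shiftDist_nonneg (ω η : ℤ → Bool) : 0 ≤ shiftDist ω η := by
  unfold shiftDist
  split_ifs <;> positivity

theorem shiftDist_self (ω : ℤ → Bool) : shiftDist ω ω = 0 := by
  simp [shiftDist]

theorem shiftDist_comm (ω η : ℤ → Bool) : shiftDist ω η = shiftDist η ω := by
  by_cases h : ω = η
  · rw [h]
  · simp only [shiftDist, if_neg h, if_neg (Ne.symm h), ne_comm]

theorem eq_of_shiftDist_eq_zero {ω η : ℤ → Bool} (h : shiftDist ω η = 0) : ω = η := by
  by_contra hne
  rw [shiftDist, if_neg hne] at h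
  exact absurd h (by positivity)

theorem shiftDist_le_max (ω η ζ : ℤ → Bool) :
    shiftDist ω ζ ≤ max (shiftDist ω η) (shiftDist η ζ) := by
  classical
  by_contra! hlt
  rw [max_lt_iff] at hlt
  by_cases h : ω = ζ
  · rw [h, shiftDist_self] at hlt
    exact absurd hlt.2 (not_lt.2 (shiftDist_nonneg _ _))
  · have hk : shiftDist ω ζ = (1 / 2) ^ sInf {i : ℕ | ω i ≠ ζ i ∨ ω (-i) ≠ ζ (-i)} := by
      rw [shiftDist, if_neg h]
    rw [hk] at hlt
    have h1 := (shiftDist_lt_iff _ _ _).1 hlt.1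
    have h2 := (shiftDist_lt_iff _ _ _).1 hlt.2
    have h3 := (shiftDist_lt_iff ω ζ _).2 fun i hi =>
      ⟨(h1 i hi).1.trans (h2 i hi).1, (h1 i hi).2.trans (h2 i hi).2⟩
    exact absurd h3 (by rw [hk]; exact lt_irrefl _)

/-- The metric `shiftDist` on `{0,1}^ℤ`; it induces the product uniformity and topology. -/
noncomputable instance shiftMetricSpace : MetricSpace (ℤ → Bool) where
  dist := shiftDist
  dist_self := shiftDist_self
  dist_comm := shiftDist_comm
  dist_triangle ω η ζ := (shiftDist_le_max ω η ζ).trans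
    (max_le_add_of_nonneg (shiftDist_nonneg _ _) (shiftDist_nonneg _ _))
  eq_of_dist_eq_zero := eq_of_shiftDist_eq_zero
  toUniformSpace := Pi.uniformSpace _
  uniformity_dist := by
    have hB : uniformity Bool = 𝓟 {p | p.1 = p.2} := rfl
    simp only [Pi.uniformity, hB, comap_principal, preimage_ofPred_eq]
    apply le_antisymm
    · simp only [le_iInf_iff, le_principal_iff]
      intro ε εpos
      obtain ⟨n, hn⟩ : ∃ n, (1 / 2 : ℝ) ^ n < ε := exists_pow_lt_of_lt_one εpos (by norm_num)
      apply mem_iInf_of_iInter (Finset.Icc (-(n : ℤ)) n).finite_toSet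
        (V := fun i => {p : (ℤ → Bool) × (ℤ → Bool) | p.1 i = p.2 i})
      · simp
      · rintro ⟨x, y⟩ hxy
        simp only [Finset.mem_coe, Finset.mem_Icc, iInter_coe_set, mem_iInter, mem_ofPred_eq]
          at hxy
        refine lt_trans ((shiftDist_lt_iff x y n).2 fun i hi => ⟨hxy i ?_, hxy (-i) ?_⟩) hn
        · omega
        · omega
    · simp only [le_iInf_iff, le_principal_iff]
      intro i
      refine mem_iInf_of_mem ((1 / 2) ^ i.natAbs : ℝ) ?_
      refine mem_iInf_of_mem (by positivity) ?_
      simp only [mem_principal, ofPred_subset_ofPred, Prod.forall]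
      intro x y hxy
      have h := (shiftDist_lt_iff x y _).1 hxy i.natAbs le_rfl
      rcases Int.natAbs_eq i with hi | hi
      · rw [hi]; exact h.1
      · rw [hi]; exact h.2

/-- The set of words of length `n` that appear in `u`. -/
def wordsOf (u : ℤ → Bool) (n : ℕ) : Set (Fin n → Bool) :=
  {w | ∃ k : ℤ, ∀ i : Fin n, w i = u (k + (i : ℕ))}

/-- `u` is eventually periodic. -/
def IsEventuallyPeriodic (u : ℤ → Bool) : Prop :=
  ∃ p : ℕ, 0 < p ∧ ∃ N : ℤ, ∀ i : ℤ, N ≤ i → u (i + p) = u i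

/-- A bi-infinite Sturmian sequence: exactly `n + 1` words of length `n` appear in it, for every
`n ≥ 1`, and it is not eventually periodic. -/
def IsSturmian (u : ℤ → Bool) : Prop :=
  (∀ n : ℕ, 1 ≤ n → (wordsOf u n).ncard = n + 1) ∧ ¬ IsEventuallyPeriodic u

/-- The orbit closure `X_u = closure {σ^k u : k ∈ ℤ}`, where `(σ^k u) i = u (k + i)`. -/
def orbitSubshift (u : ℤ → Bool) : SymbolicDynamics.FullShift.Subshift Bool ℤ where
  carrier := closure (range fun k : ℤ => SymbolicDynamics.FullShift.shift k u)
  isClosed := isClosed_closure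
  mapsTo g := by
    refine MapsTo.closure ?_ (SymbolicDynamics.FullShift.continuous_shift g)
    rintro _ ⟨k, rfl⟩
    exact ⟨k + g, SymbolicDynamics.FullShift.shift_add k g u⟩

/-- The shift map `(σ ω) i = ω (1 + i)` restricted to a two-sided subshift on the symbols `0, 1`. -/
def subshiftMap (Y : SymbolicDynamics.FullShift.Subshift Bool ℤ) : Y.carrier → Y.carrier :=
  (Y.mapsTo 1).restrict

end Sturmian

/-! ### Denjoy circle homeomorphisms -/

section Denjoy

/-- `F : ℝ → ℝ`, nondecreasing and continuous with `F (x + 1) = F x + 1`, is a lift of the map `f`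
of the circle `ℝ / ℤ`. -/
def IsCircleLift (F : CircleDeg1Lift) (f : UnitAddCircle → UnitAddCircle) : Prop :=
  Continuous F ∧ ∀ x : ℝ, ((F x : ℝ) : UnitAddCircle) = f (x : UnitAddCircle)

/-- `f` is orientation preserving with rotation number `θ mod 1`: it has a lift
(`IsCircleLift`), whose translation number is congruent to `θ` modulo `1`. -/
def HasRotationNumber (f : UnitAddCircle → UnitAddCircle) (θ : ℝ) : Prop :=
  ∃ F : CircleDeg1Lift, IsCircleLift F f ∧ (F.translationNumber : UnitAddCircle) = (θ : UnitAddCircle)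

/-- A nontrivial closed interval of the circle: the image of `[a, b]` with `a < b < a + 1`. -/
def IsNontrivialClosedArc (A : Set UnitAddCircle) : Prop :=
  ∃ a b : ℝ, a < b ∧ b < a + 1 ∧ A = (fun x : ℝ => (x : UnitAddCircle)) '' Icc a b

/-- A circle homeomorphism `f` is Denjoy if its rotation number `θ` is irrational and there are a
continuous surjection `h` of the circle with `h ∘ f = R_θ ∘ h` and a point `x₀` such that the fibers
of `h` over the `R_θ`-orbit of `x₀` are nontrivial closed intervals, and all other fibers are single
points. -/
def IsDenjoy (f : UnitAddCircle ≃ₜ UnitAddCircle) : Prop :=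
  ∃ θ : ℝ, Irrational θ ∧ HasRotationNumber f θ ∧
    ∃ (h : UnitAddCircle → UnitAddCircle) (x₀ : UnitAddCircle),
      Continuous h ∧ Function.Surjective h ∧
      (∀ x, h (f x) = h x + (θ : UnitAddCircle)) ∧
      (∀ n : ℤ, IsNontrivialClosedArc (h ⁻¹' {x₀ + n • (θ : UnitAddCircle)})) ∧
      ∀ x, (∀ n : ℤ, x ≠ x₀ + n • (θ : UnitAddCircle)) → ∃ y, h ⁻¹' {x} = {y}

end Denjoy

/-!
Both kinds of systems are one-to-one extensions of an irrational rotation of the circle, up to a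
countable set `O` of the circle; the theorem holds because such an isomorphism preserves the
measurable dynamics of the rotation while the topological complexity of the extension is linear.

*Measures.* The Lebesgue measure is the only invariant probability measure of an irrational rotation
(`eq_volume_of_measurePreserving_add`) and does not charge `O`, so it lifts to exactly one invariant
measure of the extension. A measurable partition of the extension is, up to null sets, pulled back
from the circle. As a rotation is an isometry, Markov's inequality shows that its Hamming covering
numbers are bounded independently of the length of the orbit segments
(`exists_hammingCoverNumber_le`); hence the slow metric entropy vanishes
(`uniquelyErgodic_and_metricSlowEntropy_eq_zero`).

*Denjoy homeomorphisms.* The semiconjugacy `h` is injective off the fibers over one orbit. The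
Bowen covering numbers are at most linear because the orbit segments of length `n` of a monotone
lift are separated by linearly many points (`exists_bowenCoverNumber_le_of_isCircleLift`), and at
least `n` because of the wandering interval (`exists_le_bowenCoverNumber_of_fiber`).

*Sturmian subshifts.* The Bowen covering numbers are essentially the numbers of words. For the
factor map to a rotation, having `n + 1` words of each length `n` makes the sequence balanced
(`IsSturmian.balanced`), so its partial sums stay within distance `1` of a linear function, whose
slope `α` is irrational (`exists_hasSlope_of_balanced`, `IsSturmian.irrational_of_hasSlope`). The
least intercept `ρ` of a line of slope `α` above the partial sums of `ω ∈ X_u` defines an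
equivariant map to the circle. It need not be continuous, only Borel measurable, and unless `ρ` is
in the orbit of `0` the sequence is recovered from it as the increments of `⌊k * α + ρ⌋`
(`HasSlope.mechanicalSeq_phase`, `HasSlope.mechanicalSeq_mem`).
-/

/-! ### Growth exponents -/

/-- Counts that are eventually at most `C * n ^ d` have growth exponent at most `d`. -/
theorem growthExponent_polyScale_le {N : ℕ → ℕ∞} (C d : ℕ)
    (h : ∀ᶠ n : ℕ in atTop, N n ≤ (C * n ^ d : ℕ)) : growthExponent polyScale N ≤ d := by
  refine iSup₂_le fun χ hχ => ?_
  by_contra! hlt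
  have hd : (d : ℝ) < χ := by exact_mod_cast hlt
  refine hχ.ne' (Tendsto.limsup_eq ?_)
  have h0 : Tendsto (fun n : ℕ => ENNReal.ofReal (C * (n : ℝ) ^ (-(χ - d : ℝ)))) atTop (𝓝 0) := by
    have h1 := ((tendsto_rpow_neg_atTop (sub_pos.2 hd)).comp
      tendsto_natCast_atTop_atTop).const_mul (C : ℝ)
    simpa using ENNReal.tendsto_ofReal h1
  refine tendsto_of_tendsto_of_tendsto_of_le_of_le' tendsto_const_nhds h0
    (Eventually.of_forall fun _ => zero_le) ?_
  filter_upwards [h, eventually_gt_atTop 0] with n hn hn0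
  have hn' : (0 : ℝ) < n := by exact_mod_cast hn0
  have h2 : (N n : ℝ≥0∞) ≤ ENNReal.ofReal (C * (n : ℝ) ^ d) := by
    have h3 : (N n : ℝ≥0∞) ≤ ((C * n ^ d : ℕ) : ℝ≥0∞) := by exact_mod_cast hn
    refine h3.trans (le_of_eq ?_)
    rw [← ENNReal.ofReal_natCast]
    push_cast
    rfl
  refine (ENNReal.div_le_div_right h2 _).trans (le_of_eq ?_)
  rw [polyScale, ← ENNReal.ofReal_div_of_pos (Real.rpow_pos_of_pos hn' _), neg_sub,
    Real.rpow_sub hn', Real.rpow_natCast, mul_div_assoc]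

/-- Counts that are at least `n` have growth exponent at least `1`. -/
theorem one_le_growthExponent_polyScale {N : ℕ → ℕ∞} (h : ∀ n : ℕ, (n : ℕ∞) ≤ N n) :
    1 ≤ growthExponent polyScale N := by
  have key : (0 : ℝ≥0∞) <
      limsup (fun n => (N n : ℝ≥0∞) / ENNReal.ofReal (polyScale 1 n)) atTop := by
    refine lt_of_lt_of_le zero_lt_one (le_limsup_of_frequently_le ?_)
    refine (eventually_gt_atTop 0).frequently.mono fun n hn => ?_
    have hn0 : (n : ℝ≥0∞) ≠ 0 := by exact_mod_cast hn.ne'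
    rw [polyScale, NNReal.coe_one, Real.rpow_one, ENNReal.ofReal_natCast,
      ENNReal.le_div_iff_mul_le (Or.inl hn0) (Or.inl (ENNReal.natCast_ne_top n)), one_mul]
    exact_mod_cast h n
  have := le_iSup₂ (f := fun (χ : ℝ≥0)
    (_ : 0 < limsup (fun n => (N n : ℝ≥0∞) / ENNReal.ofReal (polyScale χ n)) atTop) =>
      (χ : ℝ≥0∞)) 1 key
  simpa [growthExponent] using this

/-- Linear bounds on the Bowen covering numbers of the whole space suffice: subsets need fewer
balls, and the lower bound at one scale passes to all smaller scales. -/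
theorem topSlowEntropy_polyScale_eq_one {X : Type*} [PseudoMetricSpace X] [CompactSpace X]
    {f : X → X}
    (hub : ∀ ε > 0, ∃ C : ℕ, ∀ n : ℕ, 0 < n → bowenCoverNumber f univ ε n ≤ (C * n : ℕ))
    (hlb : ∃ ε > 0, ∀ n : ℕ, (n : ℕ∞) ≤ bowenCoverNumber f univ ε n) :
    topSlowEntropy f polyScale = 1 := by
  apply le_antisymm
  · refine iSup₂_le fun K _ => ?_
    refine limsup_le_of_le (by isBoundedDefault) ?_
    filter_upwards [self_mem_nhdsWithin] with ε hε
    obtain ⟨C, hC⟩ := hub ε hε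
    have := growthExponent_polyScale_le (N := bowenCoverNumber f K ε) C 1 (by
      filter_upwards [eventually_gt_atTop 0] with n hn
      rw [pow_one]
      exact (Dynamics.coverMincard_monotone_subset f _ n (subset_univ K)).trans (hC n hn))
    simpa using this
  · obtain ⟨ε, hε, hn⟩ := hlb
    refine le_trans ?_ (le_iSup₂ (f := fun (K : Set X) (_ : IsCompact K) =>
      limsup (fun ε : ℝ => growthExponent polyScale (bowenCoverNumber f K ε)) (𝓝[>] 0))
      univ isCompact_univ)
    refine le_limsup_of_frequently_le (Eventually.frequently ?_)
    filter_upwards [Ioo_mem_nhdsGT hε] with δ hδ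
    refine one_le_growthExponent_polyScale fun n => (hn n).trans ?_
    exact Dynamics.coverMincard_antitone f univ n fun p (hp : dist p.1 p.2 < δ) => hp.trans hδ.2

/-! ### Bounds for Bowen covering numbers -/

theorem bowenCoverNumber_univ_le {X : Type*} [PseudoMetricSpace X] {f : X → X} {ε : ℝ} {n : ℕ}
    (F : Finset X) (hF : ∀ x, ∃ y ∈ F, ∀ i < n, dist (f^[i] x) (f^[i] y) < ε) :
    bowenCoverNumber f univ ε n ≤ F.card := by
  refine Dynamics.IsDynCoverOf.coverMincard_le_card fun x _ => ?_
  obtain ⟨y, hy, h⟩ := hF x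
  refine ⟨y, hy, Dynamics.mem_dynEntourage.2 h⟩

/-- Points of which no two lie in a common `(ε, n)`-Bowen ball are at most as many as the Bowen
balls of a cover. -/
theorem card_le_bowenCoverNumber_univ {X ι : Type*} [PseudoMetricSpace X] {f : X → X} {ε : ℝ}
    {n : ℕ} (s : Finset ι) (p : ι → X)
    (hp : ∀ i ∈ s, ∀ j ∈ s, i ≠ j → ∀ y, (∀ k < n, dist (f^[k] (p i)) (f^[k] y) < ε) →
      (∀ k < n, dist (f^[k] (p j)) (f^[k] y) < ε) → False) :
    (s.card : ℕ∞) ≤ bowenCoverNumber f univ ε n := by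
  refine le_iInf₂ fun F hF => ?_
  have h1 : ∀ i, ∃ y ∈ F, ∀ k < n, dist (f^[k] (p i)) (f^[k] y) < ε := fun i => by
    obtain ⟨y, hy, h⟩ := hF (mem_univ (p i))
    exact ⟨y, hy, Dynamics.mem_dynEntourage.1 h⟩
  choose y hyF hy using h1
  have : s.card ≤ F.card := Finset.card_le_card_of_injOn y (fun i _ => hyF i) <| by
    intro i hi j hj hij
    by_contra hne
    exact hp i hi j hj hne (y i) (hy i) (by rw [hij]; exact hy j)
  exact_mod_cast this

/-! ### Extensions of irrational rotations -/

/-- An irrational rotation of the circle has no invariant probability measure besides the Lebesgue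
measure: the translations preserving a finite measure form a closed set, so that they are all
translations as soon as they contain those by a dense subgroup. -/
theorem eq_volume_of_measurePreserving_add {θ : ℝ} (hθ : Irrational θ) (μ : Measure UnitAddCircle)
    [IsProbabilityMeasure μ]
    (h : MeasurePreserving (fun t : UnitAddCircle => t + (θ : UnitAddCircle)) μ μ) :
    μ = volume := by
  have hdense : DenseRange (fun n : ℤ => n • (θ : UnitAddCircle)) :=
    AddCircle.denseRange_zsmul_coe_iff.2 (by simpa using hθ)
  have hneg : MeasurePreserving (fun t : UnitAddCircle => t - (θ : UnitAddCircle)) μ μ := by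
    refine ⟨by fun_prop, ?_⟩
    conv_lhs => rw [← h.map_eq]
    rw [Measure.map_map (by fun_prop) (by fun_prop)]
    simp [Function.comp_def]
  have hz : ∀ n : ℤ, MeasurePreserving
      (fun t : UnitAddCircle => t + n • (θ : UnitAddCircle)) μ μ := by
    intro n
    induction n using Int.induction_on with
    | zero =>
      convert MeasurePreserving.id μ using 1
      ext t
      simp
    | succ n ih =>
      convert h.comp ih using 1
      ext t
      rw [Function.comp_apply, add_smul, one_smul, add_assoc]
    | pred n ih =>
      convert hneg.comp ih using 1
      ext t
      rw [Function.comp_apply, sub_smul, one_smul, add_sub_assoc]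
  have hinv : μ.IsAddLeftInvariant := by
    refine ⟨fun s => ?_⟩
    have : IsProbabilityMeasure (μ.map (fun t => s + t)) :=
      Measure.isProbabilityMeasure_map (by fun_prop)
    refine ext_of_forall_integral_eq_of_IsFiniteMeasure fun g => ?_
    rw [integral_map (by fun_prop) (by fun_prop)]
    have hc : Continuous fun s : UnitAddCircle => ∫ t, g (s + t) ∂μ := by
      refine continuous_of_dominated (bound := fun _ => ‖g‖) (fun s => ?_) (fun s => ?_) ?_ ?_
      · fun_prop
      · exact Eventually.of_forall fun t => g.norm_coe_le_norm _
      · exact integrable_const _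
      · exact Eventually.of_forall fun t => by fun_prop
    refine congrFun (hdense.equalizer hc continuous_const (funext fun n => ?_)) s
    simp only [Function.comp_apply, add_comm (n • (θ : UnitAddCircle))]
    conv_rhs => rw [← (hz n).map_eq, integral_map (by fun_prop) (by fun_prop)]
  have h1 := Measure.isAddLeftInvariant_eq_smul μ (volume : Measure UnitAddCircle)
  have h2 := congrArg (fun m : Measure UnitAddCircle => m univ) h1
  simp only [measure_univ, Measure.smul_apply, UnitAddCircle.measure_univ] at h2
  have h3 : μ.addHaarScalarFactor (volume : Measure UnitAddCircle) = 1 := by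
    rw [ENNReal.smul_def, smul_eq_mul, mul_one] at h2
    exact_mod_cast h2.symm
  rw [h1, h3, one_smul]

/-- The expected number of visits to `B` up to time `n` is `n * μ B`, so by Markov's inequality the
points that visit `B` at a proportion of at least `ε / 2` of the times have measure less than `ε`
once `μ B < ε ^ 2 / 2`. -/
theorem measureReal_visits_lt {X : Type*} [MeasurableSpace X] {μ : Measure X}
    [IsProbabilityMeasure μ] {f : X → X} (hf : MeasurePreserving f μ μ) {B : Set X}
    (hB : MeasurableSet B) {ε : ℝ} (hε : 0 < ε) (hμB : μ B < ENNReal.ofReal (ε ^ 2 / 2)) {n : ℕ}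
    (hn : 0 < n) :
    μ.real {x | ε / 2 * n ≤ ∑ s ∈ Finset.range n, B.indicator (fun _ => (1 : ℝ)) (f^[s] x)}
      < ε := by
  have hn' : (0 : ℝ) < n := by exact_mod_cast hn
  have hm : ∀ s, Measurable fun x => B.indicator (fun _ => (1 : ℝ)) (f^[s] x) := fun s =>
    (measurable_const.indicator hB).comp (hf.measurable.iterate s)
  have hint : ∀ s, Integrable (fun x => B.indicator (fun _ => (1 : ℝ)) (f^[s] x)) μ := fun s =>
    Integrable.of_bound (hm s).aestronglyMeasurable 1 <| Eventually.of_forall fun x => by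
      by_cases hx : f^[s] x ∈ B <;> simp [hx]
  have h1 := mul_meas_ge_le_integral_of_nonneg (μ := μ)
    (f := fun x => ∑ s ∈ Finset.range n, B.indicator (fun _ => (1 : ℝ)) (f^[s] x))
    (Eventually.of_forall fun x => Finset.sum_nonneg fun s _ =>
      indicator_nonneg (fun _ _ => zero_le_one) _)
    (integrable_finsetSum _ fun s _ => hint s) (ε / 2 * n)
  have h2 : ∀ s, ∫ x, B.indicator (fun _ => (1 : ℝ)) (f^[s] x) ∂μ = μ.real B := fun s => by
    have h3 : ∀ x, B.indicator (fun _ => (1 : ℝ)) (f^[s] x)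
        = (f^[s] ⁻¹' B).indicator (fun _ => (1 : ℝ)) x := fun x => rfl
    simp_rw [h3]
    rw [integral_indicator_const _ ((hf.measurable.iterate s) hB), smul_eq_mul, mul_one,
      measureReal_def, (hf.iterate s).measure_preimage hB.nullMeasurableSet, measureReal_def]
  rw [integral_finsetSum _ fun s _ => hint s, Finset.sum_congr rfl fun s _ => h2 s,
    Finset.sum_const, Finset.card_range, nsmul_eq_mul] at h1
  have h3 : μ.real B < ε ^ 2 / 2 := by
    rw [measureReal_def]
    exact ENNReal.toReal_lt_of_lt_ofReal hμB
  have h4 : ε / 2 * n * μ.real {x | ε / 2 * n ≤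
      ∑ s ∈ Finset.range n, B.indicator (fun _ => (1 : ℝ)) (f^[s] x)} < ε / 2 * n * ε :=
    h1.trans_lt (by nlinarith)
  exact lt_of_mul_lt_mul_left h4 (by positivity)

/-- If a partition comes, up to null sets, from a partition of a compact isometric factor, then its
Hamming covering numbers are bounded independently of the length of the orbit segments. By inner
regularity, the partition of the factor has atoms that are compact, hence at positive distance from
each other, up to a set of small measure; by `measureReal_visits_lt` most points visit the
exceptional set rarely, and two such points in the same small ball of the factor are close. -/
theorem exists_hammingCoverNumber_le {X T : Type*} [MeasurableSpace X] [MetricSpace T]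
    [CompactSpace T] [MeasurableSpace T] [BorelSpace T] {μ : Measure X} [IsProbabilityMeasure μ]
    {f : X → X} (hf : MeasurePreserving f μ μ) {R : T → T} (hR : Isometry R) {h : X → T}
    (hh : Measurable h) (hfac : Function.Semiconj h f R) {k : ℕ} {P : X → Fin k}
    (hP : Measurable P) {Q : T → Fin k} (hQ : Measurable Q) (hPQ : P =ᵐ[μ] Q ∘ h) {ε : ℝ}
    (hε : 0 < ε) : ∃ M : ℕ, ∀ n : ℕ, 0 < n → hammingCoverNumber μ f P ε n ≤ M := by
  classical
  have : IsProbabilityMeasure (μ.map h) := Measure.isProbabilityMeasure_map hh.aemeasurable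
  obtain ⟨δ, hδ, hδsum⟩ := ENNReal.exists_pos_sum_of_countable
    (ENNReal.ofReal_pos.2 (by positivity : 0 < ε ^ 2 / 2)).ne' (Fin k)
  have hK : ∀ j, ∃ K ⊆ Q ⁻¹' {j}, IsCompact K ∧ μ.map h (Q ⁻¹' {j} \ K) < δ j := fun j =>
    (hQ (measurableSet_singleton j)).exists_isCompact_sdiff_lt (measure_ne_top _ _)
      (by exact_mod_cast (hδ j).ne')
  choose K hKQ hKc hKμ using hK
  obtain ⟨η, hη0, hη⟩ : ∃ η : ℝ, 0 < η ∧ ∀ i j, i ≠ j → ∀ x ∈ K i, ∀ y ∈ K j, η < dist x y := by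
    have : ∀ i j, ∀ᶠ η in 𝓝[>] (0 : ℝ), i ≠ j → ∀ x ∈ K i, ∀ y ∈ K j, η < dist x y := by
      intro i j
      by_cases hij : i = j
      · exact Eventually.of_forall fun _ h => absurd hij h
      have hd : Disjoint (K i) (K j) := by
        rw [Set.disjoint_left]
        intro x hx hy
        exact hij ((hKQ i hx).symm.trans (hKQ j hy))
      obtain ⟨r, hr, H⟩ := Metric.exists_pos_forall_lt_edist (hKc i) (hKc j).isClosed hd
      filter_upwards [Ioo_mem_nhdsGT (NNReal.coe_pos.2 hr)] with η hη _ x hx y hy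
      have := H x hx y hy
      rw [edist_nndist] at this
      refine hη.2.trans ?_
      exact_mod_cast this
    obtain ⟨η, h1, h2⟩ := ((eventually_all.2 fun i => eventually_all.2 (this i)).and
      (eventually_mem_nhdsWithin)).exists
    exact ⟨η, h2, h1⟩
  obtain ⟨t, -, htf, ht⟩ := finite_cover_balls_of_compact (isCompact_univ (X := T)) (half_pos hη0)
  set B : Set X := h ⁻¹' (⋃ j, K j)ᶜ ∪ {x | P x ≠ Q (h x)} with hBdef
  have hKm : MeasurableSet (⋃ j, K j) := MeasurableSet.iUnion fun j => (hKc j).measurableSet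
  have hBm : MeasurableSet B :=
    (hh hKm.compl).union (measurableSet_eq_fun hP (hQ.comp hh)).compl
  have hμB : μ B < ENNReal.ofReal (ε ^ 2 / 2) := by
    have h0 : μ {x | P x ≠ Q (h x)} = 0 := hPQ
    calc μ B ≤ μ (h ⁻¹' (⋃ j, K j)ᶜ) + μ {x | P x ≠ Q (h x)} := measure_union_le _ _
      _ = μ.map h (⋃ j, K j)ᶜ := by rw [h0, add_zero, Measure.map_apply hh hKm.compl]
      _ ≤ μ.map h (⋃ j, Q ⁻¹' {j} \ K j) := by
        refine measure_mono fun x hx => ?_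
        simp only [mem_compl_iff, mem_iUnion, not_exists] at hx ⊢
        exact ⟨Q x, rfl, hx _⟩
      _ ≤ ∑' j, μ.map h (Q ⁻¹' {j} \ K j) := measure_iUnion_le _
      _ ≤ ∑' j, (δ j : ℝ≥0∞) := ENNReal.tsum_le_tsum fun j => (hKμ j).le
      _ < _ := hδsum
  have hRi : ∀ s, Isometry R^[s] := fun s => by
    induction s with
    | zero => exact isometry_id
    | succ s ih => exact ih.comp hR
  refine ⟨htf.toFinset.card, fun n hn => ?_⟩
  have hn' : (0 : ℝ) < n := by exact_mod_cast hn
  set G : Set X := {x | ∑ s ∈ Finset.range n, B.indicator (fun _ => (1 : ℝ)) (f^[s] x)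
    < ε / 2 * n} with hG
  have hGm : MeasurableSet G := by
    refine measurableSet_lt (Finset.measurable_sum _ fun s _ => ?_) measurable_const
    exact (measurable_const.indicator hBm).comp (hf.measurable.iterate s)
  have hGμ : 1 - ε < μ.real G := by
    have h1 := measureReal_visits_lt hf hBm hε hμB hn
    have h2 : Gᶜ = {x | ε / 2 * n ≤
        ∑ s ∈ Finset.range n, B.indicator (fun _ => (1 : ℝ)) (f^[s] x)} := by
      ext x
      simp [hG]
    rw [← h2, probReal_compl_eq_one_sub hGm] at h1
    linarith
  have hclose : ∀ x ∈ G, ∀ y ∈ G, dist (h x) (h y) < η → hammingDistance f P n x y < ε := by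
    intro x hx y hy hxy
    have hs : ∀ s, P (f^[s] x) ≠ P (f^[s] y) → f^[s] x ∈ B ∨ f^[s] y ∈ B := by
      intro s
      contrapose!
      rintro ⟨h1, h2⟩
      simp only [hBdef, mem_union, mem_preimage, mem_compl_iff, mem_iUnion, not_or, not_not,
        mem_ofPred_eq] at h1 h2
      obtain ⟨⟨i, hi⟩, h1⟩ := h1
      obtain ⟨⟨j, hj⟩, h2⟩ := h2
      rw [h1, h2, show Q (h (f^[s] x)) = i from hKQ i hi, show Q (h (f^[s] y)) = j from hKQ j hj]
      by_contra hij
      have h3 := hη i j hij _ hi _ hj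
      rw [(hfac.iterate_right s).eq, (hfac.iterate_right s).eq, (hRi s).dist_eq] at h3
      exact lt_asymm h3 hxy
    have h1 : (n : ℝ) - ((Finset.range n).filter fun s => P (f^[s] x) = P (f^[s] y)).card ≤
        ∑ s ∈ Finset.range n, B.indicator (fun _ => (1 : ℝ)) (f^[s] x) +
        ∑ s ∈ Finset.range n, B.indicator (fun _ => (1 : ℝ)) (f^[s] y) := by
      rw [← Finset.sum_add_distrib, Finset.card_filter, sub_le_iff_le_add, Nat.cast_sum,
        ← Finset.sum_add_distrib]
      calc (n : ℝ) = ∑ s ∈ Finset.range n, (1 : ℝ) := by simp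
        _ ≤ _ := Finset.sum_le_sum fun s _ => ?_
      have h0 : ∀ z : X, 0 ≤ B.indicator (fun _ => (1 : ℝ)) z :=
        fun z => indicator_nonneg (fun _ _ => zero_le_one) _
      have := h0 (f^[s] x)
      have := h0 (f^[s] y)
      by_cases hp : P (f^[s] x) = P (f^[s] y)
      · rw [if_pos hp]
        push_cast
        linarith
      · rcases hs s hp with hb | hb
        · rw [indicator_of_mem hb, if_neg hp]
          push_cast
          linarith
        · rw [indicator_of_mem hb, if_neg hp]
          push_cast
          linarith
    have h2 : (n : ℝ) - ((Finset.range n).filter fun s => P (f^[s] x) = P (f^[s] y)).card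
        < ε * n := by
      have := hx.out
      have := hy.out
      linarith
    rw [hammingDistance, one_sub_div hn'.ne', div_lt_iff₀ hn']
    exact h2
  -- One point of `G` over each ball of the finite cover that meets the image of `G`.
  have hcenter : ∀ z, ∃ x : X, (∃ y ∈ G, h y ∈ Metric.ball z (η / 2)) →
      x ∈ G ∧ h x ∈ Metric.ball z (η / 2) := by
    intro z
    by_cases H : ∃ y ∈ G, h y ∈ Metric.ball z (η / 2)
    · obtain ⟨y, hy⟩ := H
      exact ⟨y, fun _ => hy⟩
    · have : Nonempty X := μ.nonempty_of_neZero
      exact ⟨Classical.arbitrary X, fun h => absurd h H⟩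
  choose x hx using hcenter
  have hF : 1 - ε < μ.real (⋃ y ∈ htf.toFinset.image x, hammingBall f P n ε y) := by
    refine hGμ.trans_le (measureReal_mono (fun y hy => ?_) (measure_ne_top _ _))
    obtain ⟨z, hz, hyz⟩ := mem_iUnion₂.1 (ht (mem_univ (h y)))
    obtain ⟨h1, h2⟩ := hx z ⟨y, hy, hyz⟩
    refine mem_iUnion₂.2 ⟨x z, Finset.mem_image_of_mem _ (htf.mem_toFinset.2 hz), ?_⟩
    refine hclose _ h1 _ hy ?_
    have h3 := dist_triangle_right (h (x z)) (h y) z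
    rw [Metric.mem_ball] at h2 hyz
    linarith
  refine (iInf₂_le (htf.toFinset.image x) hF).trans ?_
  exact_mod_cast Finset.card_image_le

theorem metricSlowEntropy_polyScale_eq_zero {X : Type*} [MeasurableSpace X] {μ : Measure X}
    {f : X → X} (h : ∀ (k : ℕ) (P : X → Fin k), Measurable P → ∀ ε > 0,
      ∃ M : ℕ, ∀ n : ℕ, 0 < n → hammingCoverNumber μ f P ε n ≤ M) :
    metricSlowEntropy μ f polyScale = 0 := by
  refine le_antisymm (iSup_le fun k => iSup₂_le fun P hP => ?_) zero_le
  refine limsup_le_of_le (by isBoundedDefault) ?_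
  filter_upwards [self_mem_nhdsWithin] with ε hε
  obtain ⟨M, hM⟩ := h k P hP ε hε
  have := growthExponent_polyScale_le (N := hammingCoverNumber μ f P ε) M 0 (by
    filter_upwards [eventually_gt_atTop 0] with n hn
    simpa using hM n hn)
  simpa using this

/-- A system that is isomorphic to an irrational rotation of the circle off a countable set `O` of
the circle: `h` is the factor map, and `c` is its inverse off `O`. Such a system has exactly one
invariant probability measure, the image of the Lebesgue measure under `c`, and its slow metric
entropy at polynomial scale vanishes. -/
theorem uniquelyErgodic_and_metricSlowEntropy_eq_zero {X : Type*} [MeasurableSpace X] {f : X → X}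
    (hf : Measurable f) {θ : ℝ} (hθ : Irrational θ) {h : X → UnitAddCircle} (hh : Measurable h)
    (hfac : ∀ x, h (f x) = h x + (θ : UnitAddCircle)) {O : Set UnitAddCircle} (hO : O.Countable)
    {c : UnitAddCircle → X} (hc : Measurable c) (hch : ∀ x, h x ∉ O → c (h x) = x)
    (hcf : ∀ t ∉ O, c (t + (θ : UnitAddCircle)) = f (c t)) :
    (∃! μ : Measure X, μ ∈ invariantMeasures f) ∧
      ∀ μ ∈ invariantMeasures f, metricSlowEntropy μ f polyScale = 0 := by
  have hvol : IsProbabilityMeasure (volume : Measure UnitAddCircle) :=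
    ⟨UnitAddCircle.measure_univ⟩
  have hatom : NullSingletonClass (volume : Measure UnitAddCircle) := ⟨fun t => by
    simpa using AddCircle.volume_closedBall (T := 1) (x := t) 0⟩
  have hmap : ∀ μ ∈ invariantMeasures f, μ.map h = volume := by
    rintro μ ⟨_, hμ⟩
    have : IsProbabilityMeasure (μ.map h) := Measure.isProbabilityMeasure_map hh.aemeasurable
    refine eq_volume_of_measurePreserving_add hθ _ ⟨by fun_prop, ?_⟩
    rw [Measure.map_map (by fun_prop) hh]
    conv_rhs => rw [← hμ.map_eq, Measure.map_map hh hf]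
    congr 1
    ext x
    exact (hfac x).symm
  have hae : ∀ μ ∈ invariantMeasures f, ∀ᵐ x ∂μ, c (h x) = x := by
    intro μ hμ
    have h1 : ∀ᵐ t ∂(μ.map h), t ∉ O := by
      rw [hmap μ hμ]
      exact hO.ae_notMem _
    filter_upwards [ae_of_ae_map hh.aemeasurable h1] with x hx using hch x hx
  constructor
  · refine ⟨volume.map c, ⟨Measure.isProbabilityMeasure_map hc.aemeasurable, hf, ?_⟩, ?_⟩
    · rw [Measure.map_map hf hc]
      have h1 : f ∘ c =ᵐ[volume] c ∘ fun t => t + (θ : UnitAddCircle) := by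
        filter_upwards [hO.ae_notMem volume] with t ht using (hcf t ht).symm
      rw [Measure.map_congr h1, ← Measure.map_map hc (by fun_prop), map_add_right_eq_self]
    · intro μ hμ
      rw [← hmap μ hμ, Measure.map_map hc hh]
      exact (Measure.map_id.symm.trans (Measure.map_congr (hae μ hμ)).symm)
  · intro μ hμ
    have := hμ.1
    refine metricSlowEntropy_polyScale_eq_zero fun k P hP ε hε => ?_
    refine exists_hammingCoverNumber_le hμ.2 (R := fun t => t + (θ : UnitAddCircle))
      (isometry_add_right _) hh hfac hP (hP.comp hc) ?_ hε
    filter_upwards [hae μ hμ] with x hx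
    simp [hx]

/-! ### Circle homeomorphisms -/

theorem zsmul_coe_eq_zero_iff_of_irrational {θ : ℝ} (hθ : Irrational θ) (n : ℤ) :
    n • (θ : UnitAddCircle) = 0 ↔ n = 0 := by
  refine ⟨fun h => ?_, fun h => by rw [h, zero_smul]⟩
  by_contra hn
  rw [← AddCircle.coe_zsmul, AddCircle.coe_eq_zero_iff] at h
  obtain ⟨m, hm⟩ := h
  simp only [zsmul_eq_mul, mul_one] at hm
  exact (hθ.intCast_mul hn).ne_int m hm.symm

/-- The orbit segments of length `n` of a circle map with a monotone lift `F` need at most linearly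
many Bowen balls. The function `∑ i < n, ⌊M * F^i x⌋` is monotone in `x` and increases by `n * M`
over a period, and by monotonicity of each summand its value on `[0, 1)` determines all the
`⌊M * F^i x⌋`, hence the orbit segment up to an error of `1 / M`. -/
theorem exists_bowenCoverNumber_le_of_isCircleLift {f : UnitAddCircle → UnitAddCircle}
    {F : CircleDeg1Lift} (hF : IsCircleLift F f) {ε : ℝ} (hε : 0 < ε) :
    ∃ C : ℕ, ∀ n : ℕ, 0 < n → bowenCoverNumber f univ ε n ≤ (C * n : ℕ) := by
  classical
  obtain ⟨m, hm⟩ := exists_nat_one_div_lt hε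
  set M : ℕ := m + 1 with hM
  have hM0 : (0 : ℝ) < M := by positivity
  refine ⟨M + 1, fun n hn => ?_⟩
  have hlift : ∀ (i : ℕ) (x : ℝ), ((F^[i] x : ℝ) : UnitAddCircle) = f^[i] (x : UnitAddCircle) :=
    fun i x => ((show Function.Semiconj ((↑) : ℝ → UnitAddCircle) F f from
      hF.2).iterate_right i).eq x
  let Φ : ℝ → ℤ := fun x => ∑ i ∈ Finset.range n, ⌊M * F^[i] x⌋
  have hmono : ∀ i : ℕ, Monotone fun x => ⌊M * F^[i] x⌋ := fun i x y hxy =>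
    Int.floor_mono (mul_le_mul_of_nonneg_left (F.monotone.iterate i hxy) hM0.le)
  have hΦ : Monotone Φ := fun x y hxy => Finset.sum_le_sum fun i _ => hmono i hxy
  have hΦ1 : Φ 1 = Φ 0 + n * M := by
    have h1 : ∀ i : ℕ, ⌊M * F^[i] 1⌋ = ⌊M * F^[i] 0⌋ + M := fun i => by
      have h2 : F^[i] 1 = F^[i] 0 + 1 := by
        have := (F ^ i).map_add_one 0
        rwa [CircleDeg1Lift.coe_pow, zero_add] at this
      rw [h2, mul_add, mul_one, Int.floor_add_natCast]
    simp only [Φ, h1, Finset.sum_add_distrib, Finset.sum_const, Finset.card_range, nsmul_eq_mul]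
  have hinj : ∀ x y, x ≤ y → Φ x = Φ y → ∀ i < n, ⌊M * F^[i] x⌋ = ⌊M * F^[i] y⌋ := by
    intro x y hxy h i hi
    exact (Finset.sum_eq_sum_iff_of_le fun j _ => hmono j hxy).1 h i (Finset.mem_range.2 hi)
  have hdist : ∀ x y, Φ x = Φ y → ∀ i < n,
      dist (f^[i] (x : UnitAddCircle)) (f^[i] (y : UnitAddCircle)) < ε := by
    intro x y h i hi
    have h1 : ⌊M * F^[i] x⌋ = ⌊M * F^[i] y⌋ := by
      rcases le_total x y with hxy | hxy
      · exact hinj x y hxy h i hi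
      · exact (hinj y x hxy h.symm i hi).symm
    have h2 := Int.abs_sub_lt_one_of_floor_eq_floor h1
    rw [← mul_sub, abs_mul, abs_of_pos hM0] at h2
    rw [← hlift, ← hlift, dist_eq_norm, ← AddCircle.coe_sub]
    refine lt_of_le_of_lt (QuotientAddGroup.norm_mk_le_norm) (lt_trans ?_ hm)
    rw [Real.norm_eq_abs, lt_div_iff₀' (by positivity)]
    exact_mod_cast h2
  have hsel : ∀ v : ℤ, ∃ x : ℝ, (∃ y ∈ Ico (0 : ℝ) 1, Φ y = v) → Φ x = v := fun v => by
    by_cases H : ∃ y ∈ Ico (0 : ℝ) 1, Φ y = v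
    · exact ⟨H.choose, fun _ => H.choose_spec.2⟩
    · exact ⟨0, fun h => absurd h H⟩
  choose x hx using hsel
  refine (bowenCoverNumber_univ_le ((Finset.Icc (Φ 0) (Φ 1)).image
    fun v => (x v : UnitAddCircle)) fun z => ?_).trans ?_
  · obtain ⟨y, hy, rfl⟩ : ∃ y ∈ Ico (0 : ℝ) 1, (y : UnitAddCircle) = z := by
      have := AddCircle.coe_image_Ico_eq (1 : ℝ) 0
      rw [zero_add] at this
      exact this.ge (mem_univ z)
    refine ⟨_, Finset.mem_image_of_mem _ (Finset.mem_Icc.2 ⟨hΦ hy.1, hΦ hy.2.le⟩), ?_⟩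
    exact hdist _ _ (hx _ ⟨y, hy, rfl⟩).symm
  · have h1 : ((Finset.Icc (Φ 0) (Φ 1)).image fun v => (x v : UnitAddCircle)).card ≤ n * M + 1 := by
      refine Finset.card_image_le.trans ?_
      rw [hΦ1, Int.card_Icc]
      omega
    have h2 : n * M + 1 ≤ (M + 1) * n := by nlinarith
    exact_mod_cast h1.trans h2

/-- An interior point `m` of the wandering interval `J = h⁻¹ {x₀}` of a Denjoy homeomorphism is at
positive distance from the complement of `J`, which contains `f^k m` for all `k ≠ 0`. Hence the
points `f^(-i) m`, `i < n`, are separated by the orbit segments of length `n`. -/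
theorem exists_le_bowenCoverNumber_of_fiber {f : UnitAddCircle ≃ₜ UnitAddCircle} {θ : ℝ}
    (hθ : Irrational θ) {h : UnitAddCircle → UnitAddCircle} {x₀ : UnitAddCircle}
    (hfac : ∀ x, h (f x) = h x + (θ : UnitAddCircle))
    (hJ : IsNontrivialClosedArc (h ⁻¹' {x₀})) :
    ∃ ε > 0, ∀ n : ℕ, (n : ℕ∞) ≤ bowenCoverNumber f univ ε n := by
  obtain ⟨a, b, hab, -, hJ⟩ := hJ
  have hopen : IsOpen ((fun x : ℝ => (x : UnitAddCircle)) '' Ioo a b) :=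
    QuotientAddGroup.isOpenMap_coe _ isOpen_Ioo
  set m : UnitAddCircle := (((a + b) / 2 : ℝ) : UnitAddCircle) with hm
  obtain ⟨ε, hε, hball⟩ := Metric.isOpen_iff.1 hopen m
    ⟨(a + b) / 2, ⟨by linarith, by linarith⟩, rfl⟩
  have hball' : ∀ y, dist y m < ε → h y = x₀ := fun y hy => by
    have : y ∈ h ⁻¹' {x₀} := hJ ▸ image_mono Ioo_subset_Icc_self (hball hy)
    exact this
  have hiter : ∀ (i : ℕ) x, h (f^[i] x) = h x + (i : ℤ) • (θ : UnitAddCircle) := by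
    intro i x
    induction i with
    | zero => simp
    | succ i ih =>
      rw [Function.iterate_succ_apply', hfac, ih, Nat.cast_succ, add_smul, one_smul, add_assoc]
  have hinv : ∀ i : ℕ, f^[i] (f.symm^[i] m) = m := fun i =>
    (Function.RightInverse.iterate f.apply_symm_apply i) m
  refine ⟨ε / 2, half_pos hε, fun n => ?_⟩
  have key := card_le_bowenCoverNumber_univ (f := f) (ε := ε / 2) (n := n) (Finset.range n)
    (fun i => f.symm^[i] m) ?_
  · simpa using key
  intro i hi j _ hij y hy1 hy2
  have h1 := hy1 i (Finset.mem_range.1 hi)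
  have h2 := hy2 i (Finset.mem_range.1 hi)
  rw [hinv i] at h1
  have h3 : h (f^[i] (f.symm^[j] m)) = x₀ := by
    refine hball' _ ((dist_triangle_right _ _ (f^[i] y)).trans_lt ?_)
    linarith
  have h4 : h (f.symm^[j] m) + (j : ℤ) • (θ : UnitAddCircle) = x₀ := by
    rw [← hiter, hinv, hball' m (by simpa using hε)]
  rw [hiter, ← h4, add_right_inj, ← sub_eq_zero, ← sub_smul,
    zsmul_coe_eq_zero_iff_of_irrational hθ] at h3
  omega

/-- Off the countably many fibers that are arcs, the semiconjugacy `h` to the rotation is injective,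
so its inverse is Borel measurable there and a Denjoy homeomorphism is isomorphic to the rotation up
to null sets. -/
theorem IsDenjoy.entropy {f : UnitAddCircle ≃ₜ UnitAddCircle} (hf : IsDenjoy f) :
    topSlowEntropy f polyScale = 1 ∧ (∃! μ : Measure UnitAddCircle, μ ∈ invariantMeasures f) ∧
      ∀ μ ∈ invariantMeasures f, metricSlowEntropy μ f polyScale = 0 := by
  obtain ⟨θ, hθ, ⟨F, hF, -⟩, h, x₀, hc, hsurj, hfac, harc, hpt⟩ := hf
  refine ⟨topSlowEntropy_polyScale_eq_one
    (fun ε hε => exists_bowenCoverNumber_le_of_isCircleLift hF hε)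
    (exists_le_bowenCoverNumber_of_fiber hθ hfac (by simpa using harc 0)), ?_⟩
  set O : Set UnitAddCircle := range fun n : ℤ => x₀ + n • (θ : UnitAddCircle) with hO
  have hOc : O.Countable := countable_range _
  have hOadd : ∀ t ∉ O, t + (θ : UnitAddCircle) ∉ O := by
    rintro t ht ⟨n, hn⟩
    refine ht ⟨n - 1, ?_⟩
    simp only at hn ⊢
    rw [sub_smul, one_smul, ← add_sub_assoc, hn, add_sub_cancel_right]
  have hS : MeasurableSet (h ⁻¹' O)ᶜ := (hc.measurable hOc.measurableSet).compl
  have : StandardBorelSpace ((h ⁻¹' O)ᶜ : Set UnitAddCircle) := hS.standardBorel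
  have hemb : MeasurableEmbedding fun x : ((h ⁻¹' O)ᶜ : Set UnitAddCircle) => h x := by
    refine (hc.measurable.comp measurable_subtype_coe).measurableEmbedding ?_
    rintro ⟨x, hx⟩ ⟨y, hy⟩ hxy
    obtain ⟨z, hz⟩ := hpt (h x) fun n hn => hx ⟨n, hn.symm⟩
    have h1 : x ∈ h ⁻¹' {h x} := rfl
    have h2 : y ∈ h ⁻¹' {h x} := hxy.symm
    rw [hz] at h1 h2
    exact Subtype.ext (h1.trans h2.symm)
  -- The inverse of `h` on the complement of `O`, extended arbitrarily.
  obtain ⟨c, hcm, hcc⟩ := hemb.exists_measurable_extend measurable_subtype_coe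
    fun _ => ⟨(0 : UnitAddCircle)⟩
  have hch : ∀ x, h x ∉ O → c (h x) = x := fun x hx => congrFun hcc ⟨x, hx⟩
  refine uniquelyErgodic_and_metricSlowEntropy_eq_zero f.continuous.measurable hθ hc.measurable
    hfac hOc hcm hch fun t ht => ?_
  obtain ⟨x, rfl⟩ := hsurj t
  rw [hch x ht, ← hfac, hch (f x) (by rw [hfac]; exact hOadd _ ht)]

/-! ### Right special words of Sturmian sequences -/

/-- The word of length `k` that appears in `u` at the position `t`. -/
def wordAt (u : ℤ → Bool) (k : ℕ) (t : ℤ) : Fin k → Bool := fun i => u (t + (i : ℕ))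

theorem wordAt_eq_iff {u : ℤ → Bool} {k : ℕ} {s t : ℤ} :
    wordAt u k s = wordAt u k t ↔ ∀ i : ℕ, i < k → u (s + i) = u (t + i) :=
  ⟨fun h i hi => congrFun h ⟨i, hi⟩, fun h => funext fun i => h i i.2⟩

theorem wordAt_succ_eq_iff {u : ℤ → Bool} {k : ℕ} {s t : ℤ} :
    wordAt u (k + 1) s = wordAt u (k + 1) t ↔
      wordAt u k s = wordAt u k t ∧ u (s + k) = u (t + k) := by
  simp only [wordAt_eq_iff]
  refine ⟨fun h => ⟨fun i hi => h i (by omega), h k (by omega)⟩, fun h i hi => ?_⟩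
  rcases Nat.lt_succ_iff_lt_or_eq.1 hi with hi | rfl
  · exact h.1 i hi
  · exact h.2

theorem wordAt_succ_eq_iff' {u : ℤ → Bool} {k : ℕ} {s t : ℤ} :
    wordAt u (k + 1) s = wordAt u (k + 1) t ↔
      u s = u t ∧ wordAt u k (s + 1) = wordAt u k (t + 1) := by
  simp only [wordAt_eq_iff]
  refine ⟨fun h => ⟨by simpa using h 0 (by omega), fun i hi => ?_⟩, fun h i hi => ?_⟩
  · have := h (i + 1) (by omega)
    push_cast at this
    rwa [add_comm (i : ℤ) 1, ← add_assoc, ← add_assoc] at this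
  · rcases i with _ | i
    · simpa using h.1
    · have := h.2 i (by omega)
      push_cast
      rwa [add_comm (i : ℤ) 1, ← add_assoc, ← add_assoc]

theorem wordsOf_eq_range (u : ℤ → Bool) (k : ℕ) : wordsOf u k = range (wordAt u k) := by
  ext w
  exact exists_congr fun t => ⟨fun h => (funext h).symm, fun h i => congrFun h.symm i⟩

theorem wordAt_mem_wordsOf (u : ℤ → Bool) (k : ℕ) (t : ℤ) : wordAt u k t ∈ wordsOf u k :=
  ⟨t, fun _ => rfl⟩

theorem exists_occurrence (u : ℤ → Bool) (k : ℕ) :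
    ∃ pos : (Fin k → Bool) → ℤ, ∀ w ∈ wordsOf u k, wordAt u k (pos w) = w :=
  ⟨Function.invFun (wordAt u k), fun w hw => Function.invFun_eq (by rwa [wordsOf_eq_range] at hw)⟩

theorem IsSturmian.ncard_wordsOf {u : ℤ → Bool} (hu : IsSturmian u) (k : ℕ) :
    (wordsOf u k).ncard = k + 1 := by
  rcases k with _ | k
  · rw [wordsOf_eq_range, Set.ncard_eq_one.2 ⟨wordAt u 0 0, ?_⟩]
    exact Set.Subsingleton.eq_singleton_of_mem (fun _ _ _ _ => Subsingleton.elim _ _) ⟨0, rfl⟩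
  · exact hu.1 (k + 1) (by omega)

/-- `IsRightSpecialPair u k s t`: the positions `s` and `t` witness that the word of length `k` at
`s` is right special, that is, it is followed by both letters in `u`. -/
def IsRightSpecialPair (u : ℤ → Bool) (k : ℕ) (s t : ℤ) : Prop :=
  wordAt u k s = wordAt u k t ∧ u (s + k) ≠ u (t + k)

theorem IsRightSpecialPair.tail {u : ℤ → Bool} {k : ℕ} {s t : ℤ}
    (h : IsRightSpecialPair u (k + 1) s t) : IsRightSpecialPair u k (s + 1) (t + 1) := by
  refine ⟨(wordAt_succ_eq_iff'.1 h.1).2, ?_⟩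
  have := h.2
  push_cast at this
  rwa [add_comm (k : ℤ) 1, ← add_assoc, ← add_assoc] at this

theorem IsSturmian.exists_isRightSpecialPair {u : ℤ → Bool} (hu : IsSturmian u) (k : ℕ) :
    ∃ s t, IsRightSpecialPair u k s t := by
  by_contra! H
  have h1 : (wordsOf u (k + 1)).ncard ≤ (wordsOf u k).ncard := by
    refine Set.ncard_le_ncard_of_injOn (fun w => Fin.init (α := fun _ => Bool) w) ?_ ?_
      (Set.toFinite _)
    · rw [wordsOf_eq_range]
      rintro _ ⟨t, rfl⟩
      exact wordAt_mem_wordsOf u k t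
    · rw [wordsOf_eq_range]
      rintro _ ⟨s, rfl⟩ _ ⟨t, rfl⟩ hst
      have hst' : wordAt u k s = wordAt u k t := hst
      refine wordAt_succ_eq_iff.2 ⟨hst', ?_⟩
      by_contra hne
      exact H s t ⟨hst', hne⟩
  rw [hu.ncard_wordsOf, hu.ncard_wordsOf] at h1
  omega

/-- A Sturmian sequence has only one right special word of each length: a second one would give at
least two more words of length `k + 1` than words of length `k`. -/
theorem IsSturmian.wordAt_eq_of_isRightSpecialPair {u : ℤ → Bool} (hu : IsSturmian u) {k : ℕ}
    {s t s' t' : ℤ} (h : IsRightSpecialPair u k s t) (h' : IsRightSpecialPair u k s' t') :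
    wordAt u k s = wordAt u k s' := by
  by_contra hne
  set A : Set (Fin (k + 1) → Bool) := {wordAt u (k + 1) s, wordAt u (k + 1) s'} with hA
  have hAsub : A ⊆ wordsOf u (k + 1) := by
    rintro w (rfl | rfl)
    exacts [wordAt_mem_wordsOf _ _ _, wordAt_mem_wordsOf _ _ _]
  have hAcard : A.ncard = 2 := Set.ncard_pair fun h => hne (wordAt_succ_eq_iff.1 h).1
  have hsurj : wordsOf u k ⊆
      (fun w => Fin.init (α := fun _ => Bool) w) '' (wordsOf u (k + 1) \ A) := by
    have hin : ∀ x y, wordAt u (k + 1) y ∉ A → wordAt u k x = wordAt u k y → wordAt u k x ∈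
        (fun w => Fin.init (α := fun _ => Bool) w) '' (wordsOf u (k + 1) \ A) :=
      fun x y hy hxy => ⟨_, ⟨wordAt_mem_wordsOf u (k + 1) y, hy⟩, hxy.symm⟩
    rw [wordsOf_eq_range u k]
    rintro _ ⟨x, rfl⟩
    by_cases hx : wordAt u (k + 1) x ∈ A
    · rcases hx with hx | hx
      · have hx1 := (wordAt_succ_eq_iff.1 hx).1
        refine hin x t ?_ (hx1.trans h.1)
        rintro (ht | ht)
        · exact h.2 (wordAt_succ_eq_iff.1 ht).2.symm
        · exact hne (h.1.trans (wordAt_succ_eq_iff.1 ht).1)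
      · have hx1 := (wordAt_succ_eq_iff.1 hx).1
        refine hin x t' ?_ (hx1.trans h'.1)
        rintro (ht | ht)
        · exact hne ((h'.1.trans (wordAt_succ_eq_iff.1 ht).1).symm)
        · exact h'.2 (wordAt_succ_eq_iff.1 ht).2.symm
    · exact hin x x hx rfl
  have h1 := (Set.ncard_le_ncard hsurj (Set.toFinite _)).trans
    (Set.ncard_image_le (Set.toFinite _))
  have h2 := Set.ncard_sdiff_add_ncard_of_subset hAsub (Set.toFinite _)
  rw [hu.ncard_wordsOf] at h1 h2
  omega

/-- The right special word of length `k` appears in every run of `k + 1` consecutive positions.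
Otherwise, two of these positions carry the same one of the `k` remaining words, and as none of the
words met from there on is right special, the sequence repeats itself forever. -/
theorem IsSturmian.exists_wordAt_eq {u : ℤ → Bool} (hu : IsSturmian u) {k : ℕ} {s t : ℤ}
    (h : IsRightSpecialPair u k s t) (b : ℤ) :
    ∃ i : ℕ, i ≤ k ∧ wordAt u k (b + i) = wordAt u k s := by
  classical
  by_contra! H
  have hfin : (wordsOf u k \ {wordAt u k s}).Finite := Set.toFinite _
  have hcard : hfin.toFinset.card = k := by
    rw [← Set.ncard_eq_toFinset_card _ hfin,
      Set.ncard_sdiff_singleton_of_mem (wordAt_mem_wordsOf _ _ _), hu.ncard_wordsOf,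
      Nat.add_sub_cancel]
  obtain ⟨i, hi, j, hj, hij, heq⟩ : ∃ i ∈ Finset.range (k + 1), ∃ j ∈ Finset.range (k + 1),
      i ≠ j ∧ wordAt u k (b + i) = wordAt u k (b + j) := by
    refine Finset.exists_ne_map_eq_of_card_lt_of_maps_to (t := hfin.toFinset) ?_ ?_
    · rw [hcard, Finset.card_range]
      omega
    · intro i hi
      simp only [Finset.coe_range, mem_Iio] at hi
      simp only [Set.Finite.coe_toFinset]
      exact ⟨wordAt_mem_wordsOf _ _ _, H i (by omega)⟩
  wlog hlt : i < j generalizing i j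
  · exact this j hj i hi hij.symm heq.symm (by omega)
  rw [Finset.mem_range] at hi hj
  obtain ⟨p, rfl⟩ := Nat.exists_eq_add_of_lt hlt
  set q : ℕ := p + 1 with hq
  have hnext : ∀ x y, wordAt u k x = wordAt u k y → wordAt u k x ≠ wordAt u k s →
      u (x + k) = u (y + k) := by
    intro x y hxy hx
    by_contra hne
    exact hx (hu.wordAt_eq_of_isRightSpecialPair ⟨hxy, hne⟩ h)
  have key : ∀ n : ℕ, i ≤ n → wordAt u k (b + n) = wordAt u k (b + n + q) ∧
      wordAt u k (b + n) ≠ wordAt u k s := by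
    intro n
    induction n using Nat.strong_induction_on with
    | _ n ih =>
      intro hin
      constructor
      · rcases hin.eq_or_lt with rfl | hin
        · rw [heq, hq]
          congr 1
          push_cast
          ring
        · obtain ⟨n, rfl⟩ : ∃ n', n = n' + 1 := ⟨n - 1, by omega⟩
          obtain ⟨h1, h2⟩ := ih n (by omega) (by omega)
          have h3 := (wordAt_succ_eq_iff'.1 (wordAt_succ_eq_iff.2 ⟨h1, hnext _ _ h1 h2⟩)).2
          convert h3 using 2
          · push_cast
            ring
          · push_cast
            ring
      · by_cases hnk : n ≤ k
        · exact H n hnk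
        · obtain ⟨m, rfl⟩ : ∃ m, n = m + q := ⟨n - q, by omega⟩
          obtain ⟨h1, h2⟩ := ih m (by omega) (by omega)
          rw [Nat.cast_add, ← add_assoc, ← h1]
          exact h2
  refine hu.2 ⟨q, by omega, b + i + k, fun x hx => ?_⟩
  obtain ⟨n, hn⟩ : ∃ n : ℕ, x = b + n + k := ⟨(x - b - k).toNat, by omega⟩
  obtain ⟨h1, h2⟩ := key n (by omega)
  have := hnext _ _ h1 h2
  rw [hn, this]
  congr 1
  ring

/-! ### Sturmian sequences are balanced -/

/-- The height function of `ω`, with `height ω 0 = 0` and increments `ω k ∈ {0, 1}`. -/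
noncomputable def height (ω : ℤ → Bool) (k : ℤ) : ℤ :=
  ∑ i ∈ Finset.Ico 0 k, (ω i).toInt - ∑ i ∈ Finset.Ico k 0, (ω i).toInt

@[simp] theorem height_zero (ω : ℤ → Bool) : height ω 0 = 0 := by simp [height]

theorem height_add_one (ω : ℤ → Bool) (k : ℤ) : height ω (k + 1) = height ω k + (ω k).toInt := by
  rcases le_or_gt 0 k with hk | hk
  · have h1 : Finset.Ico 0 (k + 1) = insert k (Finset.Ico 0 k) := by
      ext i
      simp only [Finset.mem_Ico, Finset.mem_insert]
      omega
    have h2 : Finset.Ico k 0 = ∅ := Finset.Ico_eq_empty (by omega)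
    have h3 : Finset.Ico (k + 1) 0 = ∅ := Finset.Ico_eq_empty (by omega)
    rw [height, height, h1, h2, h3, Finset.sum_insert (by simp)]
    ring
  · have h1 : Finset.Ico k 0 = insert k (Finset.Ico (k + 1) 0) := by
      ext i
      simp only [Finset.mem_Ico, Finset.mem_insert]
      omega
    have h2 : Finset.Ico 0 k = ∅ := Finset.Ico_eq_empty (by omega)
    have h3 : Finset.Ico 0 (k + 1) = ∅ := Finset.Ico_eq_empty (by omega)
    rw [height, height, h1, h2, h3, Finset.sum_insert (by simp)]
    ring

theorem toInt_mem (b : Bool) : 0 ≤ b.toInt ∧ b.toInt ≤ 1 := by cases b <;> decide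

theorem toInt_inj {b c : Bool} (h : b.toInt = c.toInt) : b = c := by
  revert h; cases b <;> cases c <;> decide

theorem toInt_sub_eq_one {b c : Bool} (h : b.toInt - c.toInt = 1) : b = true ∧ c = false := by
  revert h; cases b <;> cases c <;> decide

/-- In a Sturmian sequence, two words of the same length contain the same number of ones up to an
error of `1`. An unbalanced pair of minimal length has the form `0w0`, `1w1`, where minimality makes
`w` a palindrome. The right special word of length `|w| + 1` is `0w` or `1w`, and it appears in any
run of `|w| + 2` positions; but as `w` is a palindrome, `0w` does not appear in the run that starts
with `1w1`, nor does `1w` appear in the run that starts with `0w0`. -/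
theorem IsSturmian.balanced {u : ℤ → Bool} (hu : IsSturmian u) (m : ℕ) (a b : ℤ) :
    (height u (b + m) - height u b) - (height u (a + m) - height u a) ≤ 1 := by
  classical
  by_contra hcon
  have hex : ∃ m : ℕ, ∃ a b : ℤ,
      1 < (height u (b + m) - height u b) - (height u (a + m) - height u a) :=
    ⟨m, a, b, not_le.1 hcon⟩
  clear hcon
  obtain ⟨m, ⟨a, b, hD⟩, hmin'⟩ : ∃ m : ℕ, (∃ a b : ℤ,
      1 < (height u (b + m) - height u b) - (height u (a + m) - height u a)) ∧
      ∀ m' < m, ¬ ∃ a b : ℤ,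
        1 < (height u (b + m') - height u b) - (height u (a + m') - height u a) :=
    ⟨Nat.find hex, Nat.find_spec hex, fun m' hm' => Nat.find_min hex hm'⟩
  have hmin : ∀ m' < m, ∀ a b : ℤ,
      (height u (b + m') - height u b) - (height u (a + m') - height u a) ≤ 1 := by
    intro m' hm' a b
    by_contra h
    exact hmin' m' hm' ⟨a, b, not_le.1 h⟩
  clear hmin' hex
  have hstepA : ∀ j : ℕ, height u (a + (j + 1 : ℕ)) = height u (a + j) + (u (a + j)).toInt := by
    intro j
    rw [← height_add_one]
    congr 1
    push_cast
    ring
  have hstepB : ∀ j : ℕ, height u (b + (j + 1 : ℕ)) = height u (b + j) + (u (b + j)).toInt := by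
    intro j
    rw [← height_add_one]
    congr 1
    push_cast
    ring
  obtain ⟨n, rfl⟩ : ∃ n, m = n + 2 := by
    rcases m with _ | _ | n
    · simp at hD
    · rw [hstepA, hstepB] at hD
      simp only [Nat.cast_zero, add_zero] at hD
      have := toInt_mem (u a)
      have := toInt_mem (u b)
      omega
    · exact ⟨n, rfl⟩
  -- The heights relative to the starting points `a` and `b`.
  obtain ⟨A, hA⟩ : ∃ A : ℕ → ℤ, ∀ j, A j = height u (a + j) - height u a := ⟨_, fun _ => rfl⟩
  obtain ⟨B, hB⟩ : ∃ B : ℕ → ℤ, ∀ j, B j = height u (b + j) - height u b := ⟨_, fun _ => rfl⟩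
  have hA0 : A 0 = 0 := by simp [hA]
  have hB0 : B 0 = 0 := by simp [hB]
  have hAs : ∀ j, A (j + 1) = A j + (u (a + j)).toInt := fun j => by
    rw [hA, hA, hstepA]
    ring
  have hBs : ∀ j, B (j + 1) = B j + (u (b + j)).toInt := fun j => by
    rw [hB, hB, hstepB]
    ring
  have hwin : ∀ i j l : ℕ, l < n + 2 → (B (i + l) - B i) - (A (j + l) - A j) ≤ 1 := by
    intro i j l hl
    have := hmin l hl (a + j) (b + i)
    rw [add_assoc, add_assoc] at this
    rw [hA, hA, hB, hB]
    push_cast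
    linarith
  have hD' : 2 ≤ B (n + 2) - A (n + 2) := by
    rw [hA, hB]
    omega
  have hmid : ∀ j, 1 ≤ j → j ≤ n + 1 → B j = A j + 1 := by
    intro j h1 h2
    have h3 := hwin 0 0 j (by omega)
    have h4 := hwin j j (n + 2 - j) (by omega)
    rw [Nat.add_sub_cancel' (by omega : j ≤ n + 2)] at h4
    rw [zero_add] at h3
    omega
  have hfirst : u b = true ∧ u a = false := by
    have h1 := hmid 1 le_rfl (by omega)
    have h2 := hAs 0
    have h3 := hBs 0
    simp only [Nat.cast_zero, add_zero, zero_add] at h2 h3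
    exact toInt_sub_eq_one (by omega)
  have hlast : u (b + (n + 1 : ℕ)) = true ∧ u (a + (n + 1 : ℕ)) = false := by
    have h1 := hmid (n + 1) (by omega) le_rfl
    have h2 : A (n + 2) = _ := hAs (n + 1)
    have h3 : B (n + 2) = _ := hBs (n + 1)
    have h4 := toInt_mem (u (a + (n + 1 : ℕ)))
    have h5 := toInt_mem (u (b + (n + 1 : ℕ)))
    exact toInt_sub_eq_one (by omega)
  have hmidu : ∀ i : ℕ, 1 ≤ i → i ≤ n → u (a + i) = u (b + i) := by
    intro i h1 h2
    have h3 := hmid i h1 (by omega)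
    have h4 := hmid (i + 1) (by omega) (by omega)
    have h5 := hAs i
    have h6 := hBs i
    exact toInt_inj (by omega)
  have hAlast : A (n + 2) = A (n + 1) := by
    rw [hAs, hlast.2]
    simp
  have hA1 : A 1 = 0 := by
    have := hAs 0
    rw [Nat.cast_zero, add_zero, hfirst.2, hA0] at this
    simpa using this
  have hsym : ∀ i ≤ n, A (i + 1) + A (n + 1 - i) = A (n + 1) := by
    intro i hi
    have h1 := hwin (n + 1 - i) 0 (i + 1) (by omega)
    have h2 := hwin 0 (n + 1 - i) (i + 1) (by omega)
    rw [show n + 1 - i + (i + 1) = n + 2 by omega, zero_add] at h1 h2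
    have h3 := hmid (n + 1 - i) (by omega) (by omega)
    have h4 := hmid (i + 1) (by omega) (by omega)
    omega
  have hpal : ∀ i : ℕ, 1 ≤ i → i ≤ n → u (a + i) = u (a + (n + 1 - i : ℕ)) := by
    intro i h1 h2
    have h3 := hsym i h2
    have h4 := hsym (i - 1) (by omega)
    have h5 := hAs i
    have h6 := hAs (n + 1 - i)
    rw [show i - 1 + 1 = i by omega, show n + 1 - (i - 1) = n + 1 - i + 1 by omega] at h4
    exact toInt_inj (by omega)
  obtain ⟨s, t, hst⟩ := hu.exists_isRightSpecialPair (n + 1)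
  have hab : IsRightSpecialPair u n (a + 1) (b + 1) := by
    refine ⟨wordAt_eq_iff.2 fun i hi => ?_, ?_⟩
    · have := hmidu (i + 1) (by omega) (by omega)
      push_cast at this
      rwa [add_comm (i : ℤ) 1, ← add_assoc, ← add_assoc] at this
    · have h1 := hlast.1
      have h2 := hlast.2
      push_cast at h1 h2
      rw [add_comm (n : ℤ) 1, ← add_assoc] at h1 h2
      rw [h1, h2]
      decide
  have hw := wordAt_eq_iff.1 (hu.wordAt_eq_of_isRightSpecialPair hst.tail hab)
  obtain ⟨c, hc1, hc2, hc3⟩ : ∃ c : ℤ, u c ≠ u s ∧ u (c + (n + 1 : ℕ)) = u c ∧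
      ∀ i : ℕ, 1 ≤ i → i ≤ n → u (a + i) = u (c + i) := by
    cases hs : u s
    · exact ⟨b, by rw [hfirst.1]; decide, by rw [hfirst.1, hlast.1], hmidu⟩
    · exact ⟨a, by rw [hfirst.2]; decide, by rw [hfirst.2, hlast.2], fun _ _ _ => rfl⟩
  obtain ⟨i, hi, hci⟩ := hu.exists_wordAt_eq hst c
  rw [wordAt_eq_iff] at hci
  have h0 := hci 0 (by omega)
  simp only [Nat.cast_zero, add_zero] at h0
  have hi0 : i ≠ 0 := by
    rintro rfl
    exact hc1 (by simpa using h0)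
  have hi1 : i ≠ n + 1 := by
    rintro rfl
    exact hc1 (hc2.symm.trans h0)
  have h1 := hci (n + 1 - i) (by omega)
  have h2 := hw (n - i) (by omega)
  rw [show c + i + (n + 1 - i : ℕ) = c + (n + 1 : ℕ) by omega, hc2] at h1
  rw [show s + 1 + (n - i : ℕ) = s + (n + 1 - i : ℕ) by omega,
    show a + 1 + (n - i : ℕ) = a + (n + 1 - i : ℕ) by omega] at h2
  refine hc1 (h1.trans (h2.trans ?_))
  rw [← hpal i (by omega) (by omega), hc3 i (by omega) (by omega), h0]

/-! ### The slope of a balanced sequence -/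

/-- `ω` has slope `α`: the number of ones in any word of `ω` of length `m` is at distance at most
`1` from `m * α`. -/
def HasSlope (ω : ℤ → Bool) (α : ℝ) : Prop :=
  ∀ j k : ℤ, (height ω j - height ω k : ℝ) - (j - k) * α ≤ 1

theorem HasSlope.neg_one_le {ω : ℤ → Bool} {α : ℝ} (h : HasSlope ω α) (j k : ℤ) :
    -1 ≤ (height ω j - height ω k : ℝ) - (j - k) * α := by
  have := h k j
  linarith

/-- Cutting a word of length `m * n` into words of length `m`, or into words of length `n`, shows
that all the lower bounds `(S - 1) / m` for the slope lie below all the upper bounds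
`(S + 1) / n`. -/
theorem exists_hasSlope_of_balanced {u : ℤ → Bool}
    (hu : ∀ (m : ℕ) (a b : ℤ),
      (height u (b + m) - height u b) - (height u (a + m) - height u a) ≤ 1) :
    ∃ α : ℝ, HasSlope u α := by
  have hlow : ∀ (a : ℤ) (m : ℕ) (x : ℤ) (n : ℕ),
      n * (height u (a + m) - height u a - 1) ≤ height u (x + n * m) - height u x := by
    intro a m x n
    induction n with
    | zero => simp
    | succ n ih =>
      have := hu m (x + n * m) a
      rw [show x + ((n + 1 : ℕ) : ℤ) * m = x + n * m + m by push_cast; ring]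
      push_cast
      linarith
  have hupp : ∀ (b : ℤ) (n : ℕ) (x : ℤ) (m : ℕ),
      height u (x + m * n) - height u x ≤ m * (height u (b + n) - height u b + 1) := by
    intro b n x m
    induction m with
    | zero => simp
    | succ m ih =>
      have := hu n b (x + m * n)
      rw [show x + ((m + 1 : ℕ) : ℤ) * n = x + m * n + n by push_cast; ring]
      push_cast
      linarith
  have hcross : ∀ (a b : ℤ) (m n : ℕ), 0 < m → 0 < n →
      ((height u (a + m) - height u a - 1 : ℤ) : ℝ) / m ≤
        ((height u (b + n) - height u b + 1 : ℤ) : ℝ) / n := by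
    intro a b m n hm hn
    have h1 := hlow a m 0 n
    have h2 := hupp b n 0 m
    rw [mul_comm (m : ℤ) (n : ℤ)] at h2
    have h3 := h1.trans h2
    rw [div_le_div_iff₀ (by exact_mod_cast hm) (by exact_mod_cast hn), mul_comm,
      mul_comm _ (m : ℝ)]
    exact_mod_cast h3
  set L : Set ℝ := {x | ∃ (a : ℤ) (m : ℕ), 0 < m ∧
    x = ((height u (a + m) - height u a - 1 : ℤ) : ℝ) / m} with hL
  have hLne : L.Nonempty := ⟨_, 0, 1, one_pos, rfl⟩
  have hα : ∀ (b : ℤ) (n : ℕ), 0 < n →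
      sSup L ≤ ((height u (b + n) - height u b + 1 : ℤ) : ℝ) / n := by
    intro b n hn
    refine csSup_le hLne ?_
    rintro _ ⟨a, m, hm, rfl⟩
    exact hcross a b m n hm hn
  have hLb : BddAbove L := ⟨((height u (0 + (1 : ℕ)) - height u 0 + 1 : ℤ) : ℝ) / (1 : ℕ), by
    rintro _ ⟨a, m, hm, rfl⟩
    exact hcross a 0 m 1 hm one_pos⟩
  have hα' : ∀ (a : ℤ) (m : ℕ), 0 < m →
      ((height u (a + m) - height u a - 1 : ℤ) : ℝ) / m ≤ sSup L :=
    fun a m hm => le_csSup hLb ⟨a, m, hm, rfl⟩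
  refine ⟨sSup L, fun j k => ?_⟩
  rcases lt_trichotomy k j with hkj | rfl | hjk
  · obtain ⟨m, rfl⟩ : ∃ m : ℕ, j = k + m := ⟨(j - k).toNat, by omega⟩
    have hm : 0 < m := by omega
    have := hα' k m hm
    rw [div_le_iff₀ (by exact_mod_cast hm)] at this
    push_cast at this ⊢
    linarith
  · simp
  · obtain ⟨m, rfl⟩ : ∃ m : ℕ, k = j + m := ⟨(k - j).toNat, by omega⟩
    have hm : 0 < m := by omega
    have := hα j m hm
    rw [le_div_iff₀ (by exact_mod_cast hm)] at this
    push_cast at this ⊢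
    linarith

/-- If the increments of `H` over the distance `q` are at least `p`, and those over `l * q` at most
`l * p + 1`, then in each residue class modulo `q` at most one increment differs from `p`. -/
theorem finite_increment_ne {H : ℤ → ℤ} {p : ℤ} {q : ℕ} (hq : 0 < q)
    (hlow : ∀ k, p ≤ H (k + q) - H k) (hupp : ∀ (k : ℤ) (l : ℕ), H (k + l * q) - H k ≤ l * p + 1) :
    {k | H (k + q) - H k ≠ p}.Finite := by
  have hmono : ∀ (k : ℤ) (l : ℕ), l * p ≤ H (k + l * q) - H k := by
    intro k l
    induction l with
    | zero => simp
    | succ l ih =>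
      have := hlow (k + l * q)
      rw [show k + ((l + 1 : ℕ) : ℤ) * q = k + l * q + q by push_cast; ring]
      push_cast
      linarith
  have hkey : ∀ (k : ℤ) (l : ℕ), H (k + q) - H k ≠ p →
      H (k + (l + 1 : ℕ) * q + q) - H (k + (l + 1 : ℕ) * q) ≠ p → False := by
    intro k l h1 h2
    have h3 := hupp k (l + 2)
    have h4 := hmono (k + q) l
    have h5 := lt_of_le_of_ne (hlow k) h1.symm
    have h6 := lt_of_le_of_ne (hlow (k + (l + 1 : ℕ) * q)) h2.symm
    rw [show k + (l + 2 : ℕ) * (q : ℤ) = k + (l + 1 : ℕ) * q + q by push_cast; ring] at h3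
    rw [show k + q + l * (q : ℤ) = k + (l + 1 : ℕ) * q by push_cast; ring] at h4
    push_cast at *
    linarith
  refine Set.Finite.of_injOn (f := fun k : ℤ => k % q) (t := Ico 0 (q : ℤ)) ?_ ?_ (finite_Ico _ _)
  · exact fun k _ => ⟨Int.emod_nonneg _ (by omega), Int.emod_lt_of_pos _ (by omega)⟩
  · intro k hk k' hk' hkk'
    by_contra hne
    wlog hlt : k < k' generalizing k k'
    · exact this hk' hk hkk'.symm (Ne.symm hne) (by omega)
    obtain ⟨d, hd⟩ := Int.dvd_of_emod_eq_zero
      (Int.emod_eq_emod_iff_emod_sub_eq_zero.1 (show k' % q = k % q from hkk'.symm))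
    have hd0 : 0 < d := by
      by_contra hd0
      have : (q : ℤ) * d ≤ 0 := mul_nonpos_of_nonneg_of_nonpos (by omega) (by omega)
      omega
    obtain ⟨l, rfl⟩ : ∃ l : ℕ, d = (l + 1 : ℕ) := ⟨(d - 1).toNat, by omega⟩
    have hk'' : k' = k + (l + 1 : ℕ) * q := by rw [mul_comm] at hd; linarith
    subst hk''
    exact hkey k l hk hk'

/-- If the slope were a fraction `p / q`, all but finitely many words of length `q` would contain
exactly `p` ones, and `q` would be a period of the sequence from some point on. -/
theorem IsSturmian.irrational_of_hasSlope {u : ℤ → Bool} (hu : IsSturmian u) {α : ℝ}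
    (hα : HasSlope u α) : Irrational α := by
  rintro ⟨r, rfl⟩
  set q : ℕ := r.den with hq
  set p : ℤ := r.num with hp
  have hq0 : 0 < q := r.den_pos
  have hqr : (q : ℝ) * (r : ℝ) = p := by
    rw [mul_comm]
    exact_mod_cast r.mul_den_eq_num
  have hb : ∀ (k : ℤ) (l : ℕ), height u (k + l * q) - height u k ≤ l * p + 1 ∧
      l * p - 1 ≤ height u (k + l * q) - height u k := by
    intro k l
    have h1 := hα (k + l * q) k
    have h2 := hα.neg_one_le (k + l * q) k
    have h3 : (((k + l * q : ℤ) : ℝ) - k) * r = l * p := by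
      push_cast
      rw [add_sub_cancel_left, mul_assoc, hqr]
    rw [h3] at h1 h2
    constructor
    · have : ((height u (k + l * q) - height u k : ℤ) : ℝ) ≤ (l * p + 1 : ℤ) := by
        push_cast
        linarith
      exact_mod_cast this
    · have : ((l * p - 1 : ℤ) : ℝ) ≤ (height u (k + l * q) - height u k : ℤ) := by
        push_cast
        linarith
      exact_mod_cast this
  have hfin : {k | height u (k + q) - height u k ≠ p}.Finite := by
    by_cases hsign : ∀ k, p ≤ height u (k + q) - height u k
    · exact finite_increment_ne hq0 hsign fun k l => (hb k l).1
    · push Not at hsign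
      obtain ⟨k₀, hk₀⟩ := hsign
      have h1 : ∀ k, -p ≤ -height u (k + q) - -height u k := fun k => by
        have := hu.balanced q k₀ k
        omega
      have h2 := finite_increment_ne (H := fun k => -height u k) hq0 h1 fun k l => by
        have := (hb k l).2
        linarith
      refine h2.subset fun k hk h => hk ?_
      omega
  obtain ⟨N, hN⟩ := hfin.bddAbove
  refine hu.2 ⟨q, hq0, N + 1, fun k hk => ?_⟩
  have h0 : ∀ i, N < i → height u (i + q) - height u i = p := by
    intro i hi
    by_contra h
    exact absurd (hN h) (not_le.2 hi)
  have h1 := h0 k (by omega)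
  have h2 := h0 (k + 1) (by omega)
  rw [show k + 1 + q = k + q + 1 by ring, height_add_one, height_add_one] at h2
  exact toInt_inj (by omega)

/-! ### Sturmian subshifts as codings of rotations -/

open SymbolicDynamics.FullShift in
theorem height_shift (ω : ℤ → Bool) (c j : ℤ) :
    height (shift c ω) j = height ω (c + j) - height ω c := by
  induction j using Int.induction_on with
  | zero => simp
  | succ j ih =>
    rw [height_add_one, ih, ← add_assoc, height_add_one, shift_apply]
    ring
  | pred j ih =>
    have h1 := height_add_one (shift c ω) (-j - 1)
    have h2 := height_add_one ω (c + (-j - 1))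
    rw [shift_apply] at h1
    rw [show -(j : ℤ) - 1 + 1 = -j by ring] at h1
    rw [show c + (-(j : ℤ) - 1) + 1 = c + -j by ring] at h2
    linarith

theorem continuous_height (k : ℤ) : Continuous fun ω : ℤ → Bool => height ω k := by
  have h : ∀ i : ℤ, Continuous fun ω : ℤ → Bool => (ω i).toInt := fun i =>
    (continuous_of_discreteTopology (f := Bool.toInt)).comp (continuous_apply i)
  exact (continuous_finsetSum _ fun i _ => h i).sub (continuous_finsetSum _ fun i _ => h i)

/-- The points of `X_u` are those sequences all of whose finite windows appear in `u`. -/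
theorem mem_orbitSubshift_iff {u ω : ℤ → Bool} : ω ∈ (orbitSubshift u).carrier ↔
    ∀ N : ℕ, ∃ k : ℤ, ∀ j : ℤ, |j| ≤ N → ω j = u (k + j) := by
  have hdist : ∀ (N : ℕ) (k : ℤ), dist ω (SymbolicDynamics.FullShift.shift k u) < (1 / 2 : ℝ) ^ N ↔
      ∀ j : ℤ, |j| ≤ N → ω j = u (k + j) := by
    intro N k
    refine (shiftDist_lt_iff _ _ _).trans ⟨fun h j hj => ?_, fun h i hi => ⟨?_, ?_⟩⟩
    · obtain ⟨i, rfl | rfl⟩ := Int.eq_nat_or_neg j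
      · exact (h i (by simpa using hj)).1
      · exact (h i (by simpa using hj)).2
    · exact h i (by simpa using hi)
    · exact h (-i) (by simpa using hi)
  change ω ∈ closure _ ↔ _
  rw [Metric.mem_closure_iff]
  constructor
  · intro h N
    obtain ⟨_, ⟨k, rfl⟩, hk⟩ := h ((1 / 2) ^ N) (by positivity)
    exact ⟨k, (hdist N k).1 hk⟩
  · intro h ε hε
    obtain ⟨N, hN⟩ := exists_pow_lt_of_lt_one hε (by norm_num : (1 / 2 : ℝ) < 1)
    obtain ⟨k, hk⟩ := h N
    exact ⟨_, ⟨k, rfl⟩, ((hdist N k).2 hk).trans hN⟩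

theorem HasSlope.of_mem_orbitSubshift {u ω : ℤ → Bool} {α : ℝ} (h : HasSlope u α)
    (hω : ω ∈ (orbitSubshift u).carrier) : HasSlope ω α := by
  have hclosed : IsClosed {ω : ℤ → Bool | HasSlope ω α} := by
    have : {ω : ℤ → Bool | HasSlope ω α} = ⋂ (j : ℤ) (k : ℤ),
        {ω | (height ω j - height ω k : ℝ) - (j - k) * α ≤ 1} := by
      ext ω
      simp [HasSlope]
    rw [this]
    have hc : ∀ k : ℤ, Continuous fun ω : ℤ → Bool => (height ω k : ℝ) := fun k =>
      continuous_of_discreteTopology.comp (continuous_height k)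
    exact isClosed_iInter fun j => isClosed_iInter fun k =>
      isClosed_le (((hc j).sub (hc k)).sub continuous_const) continuous_const
  refine closure_minimal ?_ hclosed hω
  rintro _ ⟨c, rfl⟩ j k
  have := h (c + j) (c + k)
  rw [height_shift, height_shift]
  push_cast at this ⊢
  linarith

/-- The phase of a sequence of slope `α`: the least `ρ` such that the height function lies below
the line `k ↦ k * α + ρ`. -/
noncomputable def phase (α : ℝ) (ω : ℤ → Bool) : ℝ := ⨆ k : ℤ, ((height ω k : ℝ) - k * α)

theorem HasSlope.bddAbove {ω : ℤ → Bool} {α : ℝ} (h : HasSlope ω α) :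
    BddAbove (range fun k : ℤ => (height ω k : ℝ) - k * α) := by
  refine ⟨1, ?_⟩
  rintro _ ⟨k, rfl⟩
  simpa using h k 0

theorem HasSlope.height_le {ω : ℤ → Bool} {α : ℝ} (h : HasSlope ω α) (k : ℤ) :
    (height ω k : ℝ) ≤ k * α + phase α ω := by
  have := le_ciSup h.bddAbove k
  rw [phase]
  linarith

theorem HasSlope.le_height {ω : ℤ → Bool} {α : ℝ} (h : HasSlope ω α) (k : ℤ) :
    k * α + phase α ω ≤ height ω k + 1 := by
  have : phase α ω ≤ height ω k - k * α + 1 := ciSup_le fun j => by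
    have := h j k
    linarith
  linarith

theorem HasSlope.phase_shift {ω : ℤ → Bool} {α : ℝ} (h : HasSlope ω α) :
    phase α (SymbolicDynamics.FullShift.shift (1 : ℤ) ω) = phase α ω + α - (ω 0).toInt := by
  have h1 : height ω 1 = (ω 0).toInt := by simpa using height_add_one ω 0
  have h2 : ∀ k : ℤ, (height (SymbolicDynamics.FullShift.shift (1 : ℤ) ω) k : ℝ) - k * α =
      ((height ω (1 + k) : ℝ) - (1 + k : ℤ) * α) + (α - (ω 0).toInt) := fun k => by
    rw [height_shift, h1]
    push_cast
    ring
  rw [phase, funext h2, ← ciSup_add ?_, add_sub_assoc]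
  · congr 1
    exact (Equiv.addLeft (1 : ℤ)).iSup_comp (g := fun k : ℤ => (height ω k : ℝ) - k * α)
  · refine h.bddAbove.mono ?_
    rintro _ ⟨k, rfl⟩
    exact ⟨1 + k, rfl⟩

theorem measurable_phase (α : ℝ) : Measurable (phase α) := by
  refine Measurable.iSup fun k => Measurable.sub_const ?_ _
  exact (measurable_of_countable _).comp (continuous_height k).measurable

/-- The lower mechanical sequence of slope `α` and intercept `ρ`: the sequence of increments of
`k ↦ ⌊k * α + ρ⌋`, which lie in `{0, 1}` for slopes between `0` and `1`. -/
noncomputable def mechanicalSeq (α ρ : ℝ) (k : ℤ) : Bool :=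
  decide (⌊k * α + ρ⌋ ≠ ⌊(k + 1 : ℤ) * α + ρ⌋)

theorem mechanicalSeq_eq_of_coe_eq {α ρ ρ' : ℝ} (h : (ρ : UnitAddCircle) = (ρ' : UnitAddCircle)) :
    mechanicalSeq α ρ = mechanicalSeq α ρ' := by
  obtain ⟨z, hz⟩ := (AddCircle.coe_eq_zero_iff (p := (1 : ℝ)) (x := ρ - ρ')).1 (by
    rw [AddCircle.coe_sub, h, sub_self])
  obtain rfl : ρ = ρ' + z := by
    rw [zsmul_eq_mul, mul_one] at hz
    linarith
  funext k
  simp only [mechanicalSeq, ← add_assoc, Int.floor_add_intCast, ne_eq, add_left_inj]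

theorem mechanicalSeq_add (α ρ : ℝ) :
    mechanicalSeq α (ρ + α) = SymbolicDynamics.FullShift.shift (1 : ℤ) (mechanicalSeq α ρ) := by
  funext k
  rw [SymbolicDynamics.FullShift.shift_apply, mechanicalSeq, mechanicalSeq]
  have h1 : (k : ℝ) * α + (ρ + α) = (1 + k : ℤ) * α + ρ := by push_cast; ring
  have h2 : ((k + 1 : ℤ) : ℝ) * α + (ρ + α) = (1 + k + 1 : ℤ) * α + ρ := by push_cast; ring
  rw [h1, h2]

theorem measurable_mechanicalSeq (α : ℝ) : Measurable (mechanicalSeq α) := by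
  refine measurable_pi_lambda _ fun k => measurable_to_bool ?_
  have : (fun ρ => mechanicalSeq α ρ k) ⁻¹' {true} =
      {ρ | ⌊k * α + ρ⌋ = ⌊(k + 1 : ℤ) * α + ρ⌋}ᶜ := by
    ext ρ
    simp [mechanicalSeq]
  rw [this]
  exact (measurableSet_eq_fun (Int.measurable_floor.comp (measurable_const_add _))
    (Int.measurable_floor.comp (measurable_const_add _))).compl

theorem HasSlope.mechanicalSeq_phase {ω : ℤ → Bool} {α : ℝ} (h : HasSlope ω α)
    (hne : ∀ k z : ℤ, k * α + phase α ω ≠ z) : mechanicalSeq α (phase α ω) = ω := by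
  have hfl : ∀ k : ℤ, ⌊k * α + phase α ω⌋ = height ω k := fun k => by
    refine Int.floor_eq_iff.2 ⟨h.height_le k, lt_of_le_of_ne (h.le_height k) ?_⟩
    have := hne k (height ω k + 1)
    push_cast at this
    exact this
  funext k
  rw [mechanicalSeq, hfl, hfl, height_add_one]
  cases ω k <;> simp

/-- If no point of the rotation orbit of `ρ` is an integer, the mechanical sequence lies in `X_u`:
a finite window of it only depends on `ρ` up to a small error, and the phases of the shifts of `u`
are dense modulo `1`. -/
theorem HasSlope.mechanicalSeq_mem {u : ℤ → Bool} {α : ℝ} (h : HasSlope u α) (hα : Irrational α)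
    {ρ : ℝ} (hρ : ∀ k z : ℤ, k * α + ρ ≠ z) : mechanicalSeq α ρ ∈ (orbitSubshift u).carrier := by
  rw [mem_orbitSubshift_iff]
  intro N
  -- Small perturbations of the intercept do not change the window.
  have hev : ∀ᶠ x in 𝓝 ρ, ∀ k ∈ Finset.Icc (-(N : ℤ)) (N + 1),
      ⌊k * α + ρ⌋ < k * α + x ∧ k * α + x < ⌊k * α + ρ⌋ + 1 := by
    rw [Filter.eventually_all_finset]
    intro k _
    have hc : ContinuousAt (fun x : ℝ => k * α + x) ρ := by fun_prop
    exact hc.eventually (Ioo_mem_nhds (lt_of_le_of_ne (Int.floor_le _) (hρ k _).symm)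
      (Int.lt_floor_add_one _))
  obtain ⟨m, z, hmz⟩ : ∃ m z : ℤ, ∀ k ∈ Finset.Icc (-(N : ℤ)) (N + 1),
      ⌊k * α + ρ⌋ < k * α + (m * α + phase α u - z) ∧
        k * α + (m * α + phase α u - z) < ⌊k * α + ρ⌋ + 1 := by
    obtain ⟨V, hV, hVo, hVρ⟩ := eventually_nhds_iff.1 hev
    have hdense : DenseRange (fun n : ℤ => n • (α : UnitAddCircle)) :=
      AddCircle.denseRange_zsmul_coe_iff.2 (by simpa using hα)
    have hopen : IsOpen ((fun x : ℝ => ((x - phase α u : ℝ) : UnitAddCircle)) '' V) := by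
      have : (fun x : ℝ => ((x - phase α u : ℝ) : UnitAddCircle)) '' V =
          (fun x : ℝ => (x : UnitAddCircle)) '' ((fun x => x - phase α u) '' V) := by
        rw [image_image]
      rw [this]
      exact QuotientAddGroup.isOpenMap_coe _ ((Homeomorph.subRight (phase α u)).isOpenMap _ hVo)
    obtain ⟨m, x, hx, (hmx : ((x - phase α u : ℝ) : UnitAddCircle) = m • (α : UnitAddCircle))⟩ :=
      hdense.exists_mem_open hopen ⟨_, ρ, hVρ, rfl⟩
    obtain ⟨z, hz⟩ := (AddCircle.coe_eq_zero_iff (p := (1 : ℝ))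
      (x := m * α - (x - phase α u))).1 (by
        rw [AddCircle.coe_sub, hmx, ← zsmul_eq_mul, AddCircle.coe_zsmul, sub_self])
    refine ⟨m, z, ?_⟩
    have : m * α + phase α u - z = x := by
      rw [zsmul_eq_mul, mul_one] at hz
      linarith
    rw [this]
    exact hV x hx
  have hfl : ∀ k ∈ Finset.Icc (-(N : ℤ)) (N + 1), ⌊k * α + ρ⌋ = height u (m + k) - z := by
    intro k hk
    obtain ⟨h1, h2⟩ := hmz k hk
    have h3 := h.height_le (m + k)
    have h4 := h.le_height (m + k)
    push_cast at h3 h4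
    have h5 : ((height u (m + k) - z : ℤ) : ℝ) < (⌊k * α + ρ⌋ + 1 : ℤ) := by
      push_cast
      linarith
    have h6 : ((⌊k * α + ρ⌋ : ℤ) : ℝ) < (height u (m + k) - z + 1 : ℤ) := by
      push_cast
      linarith
    have h7 := Int.cast_lt.1 h5
    have h8 := Int.cast_lt.1 h6
    omega
  refine ⟨m, fun j hj => ?_⟩
  rw [abs_le] at hj
  rw [mechanicalSeq, hfl j (Finset.mem_Icc.2 ⟨by omega, by omega⟩),
    hfl (j + 1) (Finset.mem_Icc.2 ⟨by omega, by omega⟩), ← add_assoc, height_add_one]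
  cases u (m + j) <;> simp

/-! ### Invariant measures and entropy of Sturmian subshifts -/

theorem subshiftMap_iterate (Y : SymbolicDynamics.FullShift.Subshift Bool ℤ) (i : ℕ)
    (x : Y.carrier) (j : ℤ) : ((subshiftMap Y)^[i] x).1 j = x.1 (i + j) := by
  induction i generalizing x with
  | zero => simp
  | succ i ih =>
    rw [Function.iterate_succ_apply, ih]
    exact congrArg x.1 (show 1 + (i + j) = ((i + 1 : ℕ) : ℤ) + j by push_cast; ring)

theorem measurable_subshiftMap (Y : SymbolicDynamics.FullShift.Subshift Bool ℤ) :
    Measurable (subshiftMap Y) :=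
  ((SymbolicDynamics.FullShift.continuous_shift (1 : ℤ)).measurable.comp
    measurable_subtype_coe).subtype_mk

/-- Off the orbit of `0` under the rotation by the slope, the phase modulo `1` and the mechanical
sequences are inverse to each other, so that a Sturmian subshift is an almost one-to-one extension
of an irrational rotation. -/
theorem IsSturmian.uniquelyErgodic_and_metricSlowEntropy_eq_zero {u : ℤ → Bool}
    (hu : IsSturmian u) :
    (∃! μ : Measure (orbitSubshift u).carrier,
      μ ∈ invariantMeasures (subshiftMap (orbitSubshift u))) ∧
      ∀ μ ∈ invariantMeasures (subshiftMap (orbitSubshift u)),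
        metricSlowEntropy μ (subshiftMap (orbitSubshift u)) polyScale = 0 := by
  classical
  obtain ⟨α, hα⟩ := exists_hasSlope_of_balanced hu.balanced
  have hirr := hu.irrational_of_hasSlope hα
  set O : Set UnitAddCircle := range fun k : ℤ => k • (α : UnitAddCircle) with hO
  have hOc : O.Countable := countable_range _
  have hOadd : ∀ t ∉ O, t + (α : UnitAddCircle) ∉ O := by
    rintro t ht ⟨n, hn⟩
    refine ht ⟨n - 1, ?_⟩
    simp only at hn ⊢
    rw [sub_smul, one_smul, hn, add_sub_cancel_right]
  have hne : ∀ ρ : ℝ, (ρ : UnitAddCircle) ∉ O → ∀ k z : ℤ, k * α + ρ ≠ z := by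
    rintro ρ hρ k z h
    refine hρ ⟨-k, ?_⟩
    have h1 : ((k * α + ρ : ℝ) : UnitAddCircle) = 0 :=
      (AddCircle.coe_eq_zero_iff _).2 ⟨z, by rw [zsmul_eq_mul, mul_one, h]⟩
    rw [AddCircle.coe_add, ← zsmul_eq_mul, AddCircle.coe_zsmul] at h1
    simp only [neg_smul]
    exact neg_eq_of_add_eq_zero_right h1
  have hmem : u ∈ (orbitSubshift u).carrier := mem_orbitSubshift_iff.2 fun N => ⟨0, fun j _ => by
    rw [zero_add]⟩
  set rep : UnitAddCircle → ℝ := fun t => (AddCircle.measurableEquivIoc (1 : ℝ) 0 t : ℝ) with hrep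
  have hrepm : Measurable rep :=
    measurable_subtype_coe.comp (AddCircle.measurableEquivIoc (1 : ℝ) 0).measurable
  have hrepc : ∀ t, (rep t : UnitAddCircle) = t := fun t =>
    (AddCircle.measurableEquivIoc (1 : ℝ) 0).symm_apply_apply t
  -- The value on the countable set `O` is irrelevant, but has to be a point of `X_u`.
  set c₀ : UnitAddCircle → ℤ → Bool :=
    fun t => if t ∈ O then u else mechanicalSeq α (rep t) with hc₀
  have hc₀m : Measurable c₀ := Measurable.ite hOc.measurableSet measurable_const
    ((measurable_mechanicalSeq α).comp hrepm)
  have hc₀X : ∀ t, c₀ t ∈ (orbitSubshift u).carrier := by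
    intro t
    by_cases ht : t ∈ O
    · simp only [hc₀, if_pos ht, hmem]
    · simp only [hc₀, if_neg ht]
      exact hα.mechanicalSeq_mem hirr (hne _ (by rwa [hrepc]))
  refine _root_.uniquelyErgodic_and_metricSlowEntropy_eq_zero
    (h := fun x => ((phase α x.1 : ℝ) : UnitAddCircle)) (c := fun t => ⟨c₀ t, hc₀X t⟩) (O := O)
    (measurable_subshiftMap _) hirr ?_ ?_ hOc hc₀m.subtype_mk ?_ ?_
  · exact AddCircle.measurable_mk'.comp ((measurable_phase α).comp measurable_subtype_coe)
  · intro x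
    have h1 := (hα.of_mem_orbitSubshift x.2).phase_shift
    change ((phase α (SymbolicDynamics.FullShift.shift (1 : ℤ) x.1) : ℝ) : UnitAddCircle) = _
    rw [h1, AddCircle.coe_sub, AddCircle.coe_add]
    have h2 : (((x.1 0).toInt : ℝ) : UnitAddCircle) = 0 :=
      (AddCircle.coe_eq_zero_iff _).2 ⟨(x.1 0).toInt, by rw [zsmul_eq_mul, mul_one]⟩
    rw [h2, sub_zero]
  · intro x hx
    refine Subtype.ext ?_
    simp only [hc₀, if_neg hx]
    rw [mechanicalSeq_eq_of_coe_eq (hrepc _)]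
    exact (hα.of_mem_orbitSubshift x.2).mechanicalSeq_phase (hne _ hx)
  · intro t ht
    refine Subtype.ext ?_
    change c₀ (t + (α : UnitAddCircle)) = SymbolicDynamics.FullShift.shift (1 : ℤ) (c₀ t)
    simp only [hc₀, if_neg ht, if_neg (hOadd t ht)]
    rw [← mechanicalSeq_add]
    refine mechanicalSeq_eq_of_coe_eq ?_
    rw [AddCircle.coe_add, hrepc, hrepc]

/-- The Bowen balls of a subshift are given by the words of the sequence, so that the covering
numbers of a Sturmian subshift are of linear growth like the number of words. -/
theorem IsSturmian.topSlowEntropy_eq_one {u : ℤ → Bool} (hu : IsSturmian u) :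
    topSlowEntropy (subshiftMap (orbitSubshift u)) polyScale = 1 := by
  classical
  have : CompactSpace (orbitSubshift u).carrier :=
    isCompact_iff_compactSpace.1 (orbitSubshift u).isClosed.isCompact
  have hdist : ∀ (x y : (orbitSubshift u).carrier) (i m : ℕ),
      dist ((subshiftMap (orbitSubshift u))^[i] x) ((subshiftMap (orbitSubshift u))^[i] y)
        < (1 / 2 : ℝ) ^ m ↔ ∀ j : ℕ, j ≤ m → x.1 (i + j) = y.1 (i + j) ∧
          x.1 (i + -j) = y.1 (i + -j) := by
    intro x y i m
    refine (shiftDist_lt_iff _ _ _).trans ?_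
    simp only [subshiftMap_iterate]
  have hshift : ∀ k : ℤ, SymbolicDynamics.FullShift.shift k u ∈ (orbitSubshift u).carrier :=
    fun k => mem_orbitSubshift_iff.2 fun N => ⟨k, fun j _ => rfl⟩
  refine topSlowEntropy_polyScale_eq_one (fun ε hε => ?_) ⟨1, one_pos, fun n => ?_⟩
  · obtain ⟨m, hm⟩ := exists_pow_lt_of_lt_one hε (by norm_num : (1 / 2 : ℝ) < 1)
    -- For `n ≥ 1`, the number `n + 2 * m + 1` of words of length `n + 2 * m`, which determine the
    -- coordinates from `-m` to `n + m - 1`, is at most `(2 * m + 2) * n`.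
    refine ⟨2 * m + 2, fun n hn => ?_⟩
    have hfin : (wordsOf u (n + 2 * m)).Finite := Set.toFinite _
    obtain ⟨k, hk⟩ := exists_occurrence u (n + 2 * m)
    refine (bowenCoverNumber_univ_le (hfin.toFinset.image fun w =>
      (⟨_, hshift (k w + m)⟩ : (orbitSubshift u).carrier)) fun x => ?_).trans ?_
    · obtain ⟨l, hl⟩ := mem_orbitSubshift_iff.1 x.2 (n + m)
      set w := wordAt u (n + 2 * m) (l - m) with hw
      have hwmem : w ∈ wordsOf u (n + 2 * m) := wordAt_mem_wordsOf _ _ _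
      refine ⟨_, Finset.mem_image_of_mem _ (hfin.mem_toFinset.2 hwmem), fun i hi => ?_⟩
      have h1 := wordAt_eq_iff.1 ((hk w hwmem).trans hw)
      have h2 : ∀ j : ℤ, -m ≤ j → j < n + m → x.1 j = u (k w + m + j) := by
        intro j hj1 hj2
        have h3 := h1 (j + m).toNat (by omega)
        rw [show k w + ((j + m).toNat : ℤ) = k w + m + j by omega,
          show l - m + ((j + m).toNat : ℤ) = l + j by omega] at h3
        rw [h3]
        exact hl j (abs_le.2 ⟨by push_cast; omega, by push_cast; omega⟩)
      refine ((hdist _ _ _ _).2 fun j hj => ⟨?_, ?_⟩).trans hm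
      · exact h2 _ (by omega) (by omega)
      · exact h2 _ (by omega) (by omega)
    · have h1 := Finset.card_image_le (s := hfin.toFinset)
        (f := fun w => (⟨_, hshift (k w + m)⟩ : (orbitSubshift u).carrier))
      rw [← Set.ncard_eq_toFinset_card _ hfin, hu.ncard_wordsOf] at h1
      have h2 : n + 2 * m + 1 ≤ (2 * m + 2) * n := by nlinarith
      exact_mod_cast h1.trans h2
  · have hfin : (wordsOf u n).Finite := Set.toFinite _
    obtain ⟨k, hk⟩ := exists_occurrence u n
    have key := card_le_bowenCoverNumber_univ (f := subshiftMap (orbitSubshift u)) (ε := 1)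
      (n := n) hfin.toFinset (fun w => ⟨_, hshift (k w)⟩) ?_
    · rw [← Set.ncard_eq_toFinset_card _ hfin, hu.ncard_wordsOf] at key
      exact le_trans (by exact_mod_cast Nat.le_succ n) key
    · intro w hw w' hw' hne y hy hy'
      rw [hfin.mem_toFinset] at hw hw'
      refine hne ?_
      rw [← hk w hw, ← hk w' hw', wordAt_eq_iff]
      intro i hi
      have h1 := ((hdist _ _ i 0).1 (by simpa using hy i hi) 0 le_rfl).1
      have h2 := ((hdist _ _ i 0).1 (by simpa using hy' i hi) 0 le_rfl).1
      simpa using h1.trans h2.symm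

/-! ### Failure of the variational principle -/

theorem not_isVariational_of_metricSlowEntropy_eq_zero {X : Type*} [PseudoMetricSpace X]
    [MeasurableSpace X] [BorelSpace X] {f : X → X} {a : ℝ≥0 → ℕ → ℝ}
    (htop : topSlowEntropy f a = 1) (h : ∀ μ ∈ invariantMeasures f, metricSlowEntropy μ f a = 0) :
    ¬ IsVariational f a := by
  intro hv
  rw [IsVariational, htop] at hv
  refine one_ne_zero (hv.trans ?_)
  simp only [ENNReal.iSup_eq_zero]
  exact h

theorem mainTheorem1 :
    (∀ u : ℤ → Bool, IsSturmian u →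
      ¬ IsVariational (subshiftMap (orbitSubshift u)) polyScale ∧
      topSlowEntropy (subshiftMap (orbitSubshift u)) polyScale = 1 ∧
      (∃! μ : Measure (orbitSubshift u).carrier,
        μ ∈ invariantMeasures (subshiftMap (orbitSubshift u))) ∧
      ∀ μ ∈ invariantMeasures (subshiftMap (orbitSubshift u)),
        metricSlowEntropy μ (subshiftMap (orbitSubshift u)) polyScale = 0) ∧
    (∀ f : UnitAddCircle ≃ₜ UnitAddCircle, IsDenjoy f →
      ¬ IsVariational f polyScale ∧
      topSlowEntropy f polyScale = 1 ∧
      (∃! μ : Measure UnitAddCircle, μ ∈ invariantMeasures f) ∧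
      ∀ μ ∈ invariantMeasures f, metricSlowEntropy μ f polyScale = 0) := by
  refine ⟨fun u hu => ?_, fun f hf => ?_⟩
  · obtain ⟨h1, h2⟩ := hu.uniquelyErgodic_and_metricSlowEntropy_eq_zero
    have htop := hu.topSlowEntropy_eq_one
    exact ⟨not_isVariational_of_metricSlowEntropy_eq_zero htop h2, htop, h1, h2⟩
  · obtain ⟨htop, h1, h2⟩ := hf.entropy
    exact ⟨not_isVariational_of_metricSlowEntropy_eq_zero htop h2, htop, h1, h2⟩
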